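/- For $n\ge 0$ let $B_n$ be the braid group with Artin generators $\sigma_1,\dots,\sigma_{n-1}$ (relations $\sigma_i\sigma_j=\sigma_j\sigma_i$ for $|i-j|\ge 2$ and $\sigma_i\sigma_{i+1}\sigma_i=\sigma_{i+1}\sigma_i\sigma_{i+1}$), and let $\rho:B_n\to S_n$ be the homomorphism sending $\sigma_i$ to the adjacent transposition $\tau_i=(i\ i{+}1)$. A braid is *pure* if it lies in $\ker\rho$. A *permutation braid* is a braid represented by a positive word (a word in the $\sigma_i$ without inverses) in whose diagram no two strands cross more than once. Write $[x,y]=xyx^{-1}y^{-1}$. Algorithms are pseudo-code programs with integer variables and integer arrays, built from assignments, sums, differences, array reads and writes, comparisons, conditionals and while-loops; the running time is the number of executed assignments, array writes and tests. Words are given as arrays of integers, with $i$ for $\sigma_i$ or $\tau_i$ and $-i$ for $\sigma_i^{-1}$. The *canonical form* of a word in $\tau_1,\dots,\tau_{n-1}$ is the ShortLex-smallest word (shortest, then lexicographically smallest with $\tau_1<\tau_2<\cdots$) that represents the same permutation. Assume that there is an efficient algorithm for canonical forms: a program that, given any $n$ and any word $w$ of length $k$ in $\tau_1,\dots,\tau_{n-1}$,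 outputs the canonical form of $w$ in time that is bounded by a polynomial in $k$ for each fixed $n$ and by a polynomial in $n$ for each fixed $k$. Then there is a program, the same for all $n$, and a polynomial $P$ such that, given any $n$ and any braid word $w$ of length $k$ in $\sigma_1^{\pm1},\dots,\sigma_{n-1}^{\pm1}$ representing an element $b$ of the commutator subgroup $[B_n,B_n]$, the program halts after at most $P(n+k)$ steps and outputs braid words representing a pure braid $p$ and permutation braids $d_1,d_2$ such that $$b=p\cdot[d_1,d_2].$$ (In particular the running time is polynomial in $k$ for fixed $n$ and polynomial in $n$ for fixed $k$.) -/

import Mathlib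

open scoped commutatorElement

/-! ## Braid groups and the projection to the symmetric group -/

/-- The defining relations of the braid group on `n` strands. The generator with index
`i : Fin (n - 1)` is the Artin generator usually called `σ_{i+1}`. -/
def braidRels (n : ℕ) : Set (FreeGroup (Fin (n - 1))) :=
  {r | (∃ i j : Fin (n - 1), i.val + 2 ≤ j.val ∧
          r = FreeGroup.of i * FreeGroup.of j * (FreeGroup.of j * FreeGroup.of i)⁻¹) ∨
       (∃ i j : Fin (n - 1), i.val + 1 = j.val ∧
          r = FreeGroup.of i * FreeGroup.of j * FreeGroup.of i *
            (FreeGroup.of j * FreeGroup.of i * FreeGroup.of j)⁻¹)}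

/-- The braid group `B_n`. -/
abbrev BraidGroup (n : ℕ) : Type := PresentedGroup (braidRels n)

/-- The adjacent transposition exchanging the `i`-th and the `(i+1)`-th point. -/
def adjSwap (n : ℕ) (i : Fin (n - 1)) : Equiv.Perm (Fin n) :=
  Equiv.swap ⟨i.val, by have := i.isLt; omega⟩ ⟨i.val + 1, by have := i.isLt; omega⟩

theorem adjSwap_rels (n : ℕ) :
    ∀ r ∈ braidRels n, FreeGroup.lift (adjSwap n) r = 1 := by
  rintro r (⟨i, j, hij, rfl⟩ | ⟨i, j, hij, rfl⟩)
  · simp only [map_mul, map_inv, FreeGroup.lift_apply_of]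
    rw [mul_inv_eq_one]
    refine (Equiv.Perm.disjoint_swap_swap ?_).commute.eq
    simp [Fin.ext_iff]
    omega
  · simp only [map_mul, map_inv, FreeGroup.lift_apply_of]
    rw [mul_inv_eq_one]
    have hj : adjSwap n j = Equiv.swap ⟨i.val + 1, by have := i.isLt; omega⟩
        ⟨i.val + 2, by have := j.isLt; omega⟩ := by
      simp only [adjSwap, ← hij]
    rw [hj, adjSwap, Equiv.swap_mul_swap_mul_swap (by simp [Fin.ext_iff]) (by simp [Fin.ext_iff]),
      Equiv.swap_comm (⟨i.val, _⟩ : Fin n), Equiv.swap_comm (⟨i.val + 1, _⟩ : Fin n) ⟨i.val + 2, _⟩,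
      Equiv.swap_mul_swap_mul_swap (by simp [Fin.ext_iff]) (by simp [Fin.ext_iff])]
    exact Equiv.swap_comm _ _

/-- The homomorphism `ρ : B_n → S_n` sending each Artin generator to the corresponding
adjacent transposition. -/
def braidToPerm (n : ℕ) : BraidGroup n →* Equiv.Perm (Fin n) :=
  PresentedGroup.toGroup (adjSwap_rels n)

/-- A pure braid: every strand ends at the position where it begins. -/
def IsPureBraid (n : ℕ) (b : BraidGroup n) : Prop := b ∈ (braidToPerm n).ker

/-! ## Words -/

/-- Words in the Artin generators and their inverses; `(i, true)` stands for the generator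
with index `i` and `(i, false)` for its inverse. -/
abbrev BraidWord (n : ℕ) : Type := List (Fin (n - 1) × Bool)

/-- The braid represented by a braid word. -/
def BraidWord.toBraid {n : ℕ} (w : BraidWord n) : BraidGroup n :=
  PresentedGroup.mk (braidRels n) (FreeGroup.mk w)

/-- Words in the adjacent transpositions. -/
abbrev SymWord (n : ℕ) : Type := List (Fin (n - 1))

/-- The permutation represented by a word in the adjacent transpositions. -/
def SymWord.toPerm {n : ℕ} (w : SymWord n) : Equiv.Perm (Fin n) :=
  (w.map (adjSwap n)).prod

/-- The positive braid represented by a word in the Artin generators (without inverses). -/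
def positiveBraid {n : ℕ} (w : SymWord n) : BraidGroup n :=
  (w.map fun i => (PresentedGroup.of i : BraidGroup n)).prod

/-- The crossings of the strands in the diagram of a positive word. A strand is named by its
position at the beginning of the word; if `L p` is the name of the strand at position `p`
before the first letter `i`, then that letter crosses the strands `L i` and `L (i+1)`. -/
def crossingsFrom {n : ℕ} : (Fin n → Fin n) → SymWord n → List (Sym2 (Fin n))
  | _, [] => []
  | L, i :: w =>
      s(L ⟨i.val, by have := i.isLt; omega⟩, L ⟨i.val + 1, by have := i.isLt; omega⟩) ::
        crossingsFrom (fun p => L (adjSwap n i p)) w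

/-- A permutation braid: a positive braid in which no two strands cross twice. -/
def IsPermutationBraid (n : ℕ) (b : BraidGroup n) : Prop :=
  ∃ w : SymWord n, positiveBraid w = b ∧ (crossingsFrom id w).Nodup

/-- `v` is the canonical form of `w`: the ShortLex-smallest word that represents the same
permutation. -/
def IsCanonicalForm {n : ℕ} (w v : SymWord n) : Prop :=
  v.toPerm = w.toPerm ∧
    ∀ u : SymWord n, u.toPerm = w.toPerm → u = v ∨ List.Shortlex (· < ·) v u

/-! ## Programs and their running time

Pseudo-code with integer variables and integer arrays. Running time is the number of executed
elementary statements (assignments, array assignments and tests). Values are only added,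
subtracted and compared, never multiplied. -/

/-- Integer expressions: constants, variables, array entries, sums and differences. -/
inductive IntExpr : Type
  | const (z : ℤ)
  | var (x : ℕ)
  | entry (a : ℕ) (i : IntExpr)
  | add (e f : IntExpr)
  | sub (e f : IntExpr)

/-- Tests. -/
inductive TestExpr : Type
  | eq (e f : IntExpr)
  | lt (e f : IntExpr)
  | neg (c : TestExpr)

/-- Programs. -/
inductive Program : Type
  | skip
  | assign (x : ℕ) (e : IntExpr)
  | store (a : ℕ) (i e : IntExpr)
  | seq (P Q : Program)
  | branch (c : TestExpr) (P Q : Program)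
  | loop (c : TestExpr) (P : Program)

/-- A memory state: the values of the integer variables and of the entries of the arrays.
A program mentions only finitely many of them. -/
structure Memory : Type where
  var : ℕ → ℤ
  arr : ℕ → ℤ → ℤ

def IntExpr.eval (s : Memory) : IntExpr → ℤ
  | .const z => z
  | .var x => s.var x
  | .entry a i => s.arr a (i.eval s)
  | .add e f => e.eval s + f.eval s
  | .sub e f => e.eval s - f.eval s

def TestExpr.Holds (s : Memory) : TestExpr → Prop
  | .eq e f => e.eval s = f.eval s
  | .lt e f => e.eval s < f.eval s
  | .neg c => ¬ c.Holds s

def Memory.setVar (s : Memory) (x : ℕ) (z : ℤ) : Memory where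
  var := Function.update s.var x z
  arr := s.arr

def Memory.setEntry (s : Memory) (a : ℕ) (i z : ℤ) : Memory where
  var := s.var
  arr := Function.update s.arr a (Function.update (s.arr a) i z)

/-- `Executes P s s' t`: the program `P`, started in the memory state `s`, terminates in the
memory state `s'` after exactly `t` steps. -/
inductive Executes : Program → Memory → Memory → ℕ → Prop
  | skip (s : Memory) : Executes .skip s s 1
  | assign (s : Memory) (x : ℕ) (e : IntExpr) :
      Executes (.assign x e) s (s.setVar x (e.eval s)) 1
  | store (s : Memory) (a : ℕ) (i e : IntExpr) :
      Executes (.store a i e) s (s.setEntry a (i.eval s) (e.eval s)) 1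
  | seq {P Q : Program} {s s' s'' : Memory} {t t' : ℕ} :
      Executes P s s' t → Executes Q s' s'' t' → Executes (.seq P Q) s s'' (t + t')
  | branchTrue {c : TestExpr} {P Q : Program} {s s' : Memory} {t : ℕ} :
      c.Holds s → Executes P s s' t → Executes (.branch c P Q) s s' (t + 1)
  | branchFalse {c : TestExpr} {P Q : Program} {s s' : Memory} {t : ℕ} :
      ¬ c.Holds s → Executes Q s s' t → Executes (.branch c P Q) s s' (t + 1)
  | loopFalse {c : TestExpr} {P : Program} {s : Memory} :
      ¬ c.Holds s → Executes (.loop c P) s s 1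
  | loopTrue {c : TestExpr} {P : Program} {s s' s'' : Memory} {t t' : ℕ} :
      c.Holds s → Executes P s s' t → Executes (.loop c P) s' s'' t' →
        Executes (.loop c P) s s'' (t + t' + 1)

/-- The initial memory on input `(n, w)`: variable `0` holds `n`, variable `1` holds the length
of `w`, array `0` holds the letters of `w`, and everything else is `0`. -/
def Memory.input (n : ℕ) (w : List ℤ) : Memory where
  var := fun x => if x = 0 then (n : ℤ) else if x = 1 then (w.length : ℤ) else 0
  arr := fun a i => if a = 0 ∧ 0 ≤ i then w.getD i.toNat 0 else 0

/-- The `j`-th output `w` is held in the memory: variable `j` holds the length of `w` and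
array `j` begins with the letters of `w`. -/
def Memory.HoldsOutput (s : Memory) (j : ℕ) (w : List ℤ) : Prop :=
  s.var j = (w.length : ℤ) ∧ ∀ i < w.length, s.arr j (i : ℤ) = w.getD i 0

/-- Letters as integers: the generator with index `i`, i.e. the one usually numbered `i + 1`,
is the integer `i + 1`. -/
def SymWord.code {n : ℕ} (w : SymWord n) : List ℤ :=
  w.map fun i => (i.val : ℤ) + 1

/-- As for `SymWord.code`, and the inverse of a generator is the negative integer. -/
def BraidWord.code {n : ℕ} (w : BraidWord n) : List ℤ :=
  w.map fun x => if x.2 then (x.1.val : ℤ) + 1 else -((x.1.val : ℤ) + 1)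

/-- A time bound `T n k`, for `n` strands and words of length `k`, that is polynomial in `k` for
every fixed `n` and polynomial in `n` for every fixed `k`. -/
def SeparatelyPolynomial (T : ℕ → ℕ → ℕ) : Prop :=
  (∀ n, ∃ P : Polynomial ℕ, ∀ k, T n k ≤ P.eval k) ∧
    (∀ k, ∃ P : Polynomial ℕ, ∀ n, T n k ≤ P.eval n)

/-- A time bound that is polynomial in `n` and `k` jointly; in particular it is separately
polynomial. -/
def JointlyPolynomial (T : ℕ → ℕ → ℕ) : Prop :=
  ∃ P : Polynomial ℕ, ∀ n k, T n k ≤ P.eval (n + k)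

/-- The program `A` brings every word in the generators of every `S_n` into canonical form,
within the time bound `T`. -/
def ComputesCanonicalForm (A : Program) (T : ℕ → ℕ → ℕ) : Prop :=
  ∀ (n : ℕ) (w : SymWord n), ∃ (s : Memory) (t : ℕ) (v : SymWord n),
    Executes A (Memory.input n w.code) s t ∧ t ≤ T n w.length ∧
      IsCanonicalForm w v ∧ s.HoldsOutput 0 v.code

/-- Given `n` and a braid word `w` that represents an element `b` of the commutator subgroup of
`B_n`, the program `C` outputs, within the time bound `T`, braid words for a pure braid `p` and
for permutation braids `d₁`, `d₂` such that `b = p * ⁅d₁, d₂⁆`. -/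
def ComputesPureCommutatorForm (C : Program) (T : ℕ → ℕ → ℕ) : Prop :=
  ∀ (n : ℕ) (w : BraidWord n), w.toBraid ∈ commutator (BraidGroup n) →
    ∃ (s : Memory) (t : ℕ) (p d₁ d₂ : BraidWord n),
      Executes C (Memory.input n w.code) s t ∧ t ≤ T n w.length ∧
        s.HoldsOutput 0 p.code ∧ s.HoldsOutput 1 d₁.code ∧ s.HoldsOutput 2 d₂.code ∧
        IsPureBraid n p.toBraid ∧
        IsPermutationBraid n d₁.toBraid ∧ IsPermutationBraid n d₂.toBraid ∧
        w.toBraid = p.toBraid * ⁅d₁.toBraid, d₂.toBraid⁆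

/-!
The program works in the symmetric group only. Let `π` be the permutation of the braid word `w`.
It is even, since `w` represents an element of the commutator subgroup. If `π = ⁅x, y⁆`, and `d₁`,
`d₂` are permutation braids over `x` and `y`, then `p = w * ⁅d₁, d₂⁆⁻¹` is pure, and a word for
`p` can be written down from words for `d₁` and `d₂`. Two things have to be computed in polynomial
time.

*The permutations `x` and `y`.* It suffices to write `π = A * B⁻¹` with two `n`-cycles `A` and
`B`: there is `e` with `e * B * e⁻¹ = A`, which is found by walking along both cycles
simultaneously, and then `⁅A, e⁻¹⁆ = A * B⁻¹ = π` (`commutatorElement_eq_of_conj`). Begin with the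
cycle `B : y ↦ y + 1` and `A = π * B`, and replace `(A, B)` by `(A * t, B * t)` for suitable
3-cycles `t`, which preserves `A * B⁻¹`. If the three points of `t` lie in different cycles of
`A`, these are merged (`sameCycle_mul_rot`), so that the number of cycles of `A` decreases. The
product `B * t` is an `n`-cycle again if `t` has the right one of the two possible orientations.
This is automatic when the points are met in increasing order, because `B` then still maps `y` to
`y + 1` from the last of the three points on (`sameCycle_mul_rot_of_tail`). When no three cycles
of `A` are left, `A` is an `n`-cycle, since a permutation with two cycles does not have the sign
of `B` (`sameCycle_of_sign_eq`).

*Permutation braids over `x` and `y`.* Sorting the values of `x⁻¹` by exchanges of neighbours that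
are in the wrong order yields a word for `x`. No pair of values is exchanged twice, as every
exchange removes exactly one inversion (`IsInverted.of_adjSwap`), so the positive braid of this
word is a permutation braid. In the same way `e` yields a word for `y = e⁻¹`. These words have
length at most `n ^ 2`, and the running time is quadratic in `n + k`.

The programs are verified with total correctness assertions `RunsTo` that carry a time bound. They
use the following memory. Variables: `0`, `1`, `2` hold the lengths of the output words, `3` the
number of strands, `4` the length of the input; `5` and `6` count loops. Arrays: `0`, `1`, `2`
hold the output words, `3` the permutation `π`, `4` and `5` the cycles `A` and `B`, `6` and `7`
the arrangements `A⁻¹` and `e` that are sorted.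
-/

open scoped commutatorElement

/-! ### Programs with a postcondition and a time bound -/

/-- Total correctness with a time bound: started in `s`, the program `P` terminates within `T`
steps, in a memory state that satisfies `Q`. -/
def RunsTo (P : Program) (s : Memory) (T : ℕ) (Q : Memory → Prop) : Prop :=
  ∃ s' t, Executes P s s' t ∧ t ≤ T ∧ Q s'

/-- Whether the variable `x` is the target of an assignment in the program. -/
def Program.writesVar (x : ℕ) : Program → Bool
  | .skip => false
  | .assign y _ => x == y
  | .store _ _ _ => false
  | .seq P Q => P.writesVar x || Q.writesVar x
  | .branch _ P Q => P.writesVar x || Q.writesVar x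
  | .loop _ P => P.writesVar x

/-- Whether the array `a` is the target of an array assignment in the program. -/
def Program.writesArr (a : ℕ) : Program → Bool
  | .skip => false
  | .assign _ _ => false
  | .store b _ _ => a == b
  | .seq P Q => P.writesArr a || Q.writesArr a
  | .branch _ P Q => P.writesArr a || Q.writesArr a
  | .loop _ P => P.writesArr a

/-- The states `s` and `s'` agree on all variables and arrays that `P` does not write. -/
structure Frame (P : Program) (s s' : Memory) : Prop where
  var : ∀ x, P.writesVar x = false → s'.var x = s.var x
  arr : ∀ a, P.writesArr a = false → s'.arr a = s.arr a

@[simp] theorem Memory.setVar_var (s : Memory) (x : ℕ) (z : ℤ) (y : ℕ) :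
    (s.setVar x z).var y = if y = x then z else s.var y := by
  simp [Memory.setVar, Function.update_apply]

@[simp] theorem Memory.setVar_arr (s : Memory) (x : ℕ) (z : ℤ) : (s.setVar x z).arr = s.arr := rfl

@[simp] theorem Memory.setEntry_var (s : Memory) (a : ℕ) (i z : ℤ) :
    (s.setEntry a i z).var = s.var := rfl

@[simp] theorem Memory.setEntry_arr (s : Memory) (a : ℕ) (i z : ℤ) (b : ℕ) :
    (s.setEntry a i z).arr b = if b = a then Function.update (s.arr a) i z else s.arr b := by
  simp [Memory.setEntry, Function.update_apply]

theorem Frame.refl (P : Program) (s : Memory) : Frame P s s := ⟨fun _ _ => rfl, fun _ _ => rfl⟩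

theorem Frame.trans {P : Program} {s s' s'' : Memory} (h : Frame P s s') (h' : Frame P s' s'') :
    Frame P s s'' :=
  ⟨fun x hx => (h'.var x hx).trans (h.var x hx), fun a ha => (h'.arr a ha).trans (h.arr a ha)⟩

theorem Frame.of_le {P P' : Program} {s s' : Memory} (h : Frame P s s')
    (hv : ∀ x, P'.writesVar x = false → P.writesVar x = false)
    (ha : ∀ a, P'.writesArr a = false → P.writesArr a = false) : Frame P' s s' :=
  ⟨fun x hx => h.var x (hv x hx), fun a h' => h.arr a (ha a h')⟩

theorem Executes.frame {P : Program} {s s' : Memory} {t : ℕ} (h : Executes P s s' t) :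
    Frame P s s' := by
  induction h with
  | skip s => exact .refl _ _
  | assign s x e =>
    refine ⟨fun y hy => ?_, fun _ _ => rfl⟩
    simp only [Program.writesVar, beq_eq_false_iff_ne] at hy
    simp [hy]
  | store s a i e =>
    refine ⟨fun _ _ => rfl, fun b hb => ?_⟩
    simp only [Program.writesArr, beq_eq_false_iff_ne] at hb
    simp [hb]
  | seq _ _ h h' =>
    refine .trans (h.of_le ?_ ?_) (h'.of_le ?_ ?_) <;>
      simp +contextual [Program.writesVar, Program.writesArr]
  | branchTrue _ _ h =>
    refine h.of_le ?_ ?_ <;> simp +contextual [Program.writesVar, Program.writesArr]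
  | branchFalse _ _ h =>
    refine h.of_le ?_ ?_ <;> simp +contextual [Program.writesVar, Program.writesArr]
  | loopFalse _ => exact .refl _ _
  | loopTrue _ _ _ h h' => exact .trans (h.of_le (fun _ => id) (fun _ => id)) h'

namespace RunsTo

variable {P R : Program} {s : Memory} {T T' : ℕ} {Q Q' : Memory → Prop}

theorem mono (h : RunsTo P s T Q) (hT : T ≤ T') (hQ : ∀ s', Q s' → Q' s') : RunsTo P s T' Q' :=
  let ⟨s', t, he, ht, hq⟩ := h
  ⟨s', t, he, ht.trans hT, hQ s' hq⟩

theorem frame (h : RunsTo P s T Q) : RunsTo P s T (fun s' => Q s' ∧ Frame P s s') :=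
  let ⟨s', t, he, ht, hq⟩ := h
  ⟨s', t, he, ht, hq, he.frame⟩

theorem skip (h : Q s) : RunsTo .skip s 1 Q := ⟨s, 1, .skip s, le_rfl, h⟩

theorem assign {x : ℕ} {e : IntExpr} (h : Q (s.setVar x (e.eval s))) :
    RunsTo (.assign x e) s 1 Q :=
  ⟨_, 1, .assign s x e, le_rfl, h⟩

theorem store {a : ℕ} {i e : IntExpr} (h : Q (s.setEntry a (i.eval s) (e.eval s))) :
    RunsTo (.store a i e) s 1 Q :=
  ⟨_, 1, .store s a i e, le_rfl, h⟩

theorem seq (h : RunsTo P s T fun s' => RunsTo R s' T' Q) : RunsTo (.seq P R) s (T + T') Q :=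
  let ⟨_, _, he, ht, s'', _, he', ht', hq⟩ := h
  ⟨s'', _, .seq he he', Nat.add_le_add ht ht', hq⟩

theorem assignSeq {x : ℕ} {e : IntExpr} (h : RunsTo R (s.setVar x (e.eval s)) T Q) :
    RunsTo (.seq (.assign x e) R) s (1 + T) Q :=
  seq (assign h)

theorem storeSeq {a : ℕ} {i e : IntExpr} (h : RunsTo R (s.setEntry a (i.eval s) (e.eval s)) T Q) :
    RunsTo (.seq (.store a i e) R) s (1 + T) Q :=
  seq (store h)

theorem branch {c : TestExpr} (h : c.Holds s → RunsTo P s T Q)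
    (h' : ¬ c.Holds s → RunsTo R s T' Q) :
    RunsTo (.branch c P R) s (max T T' + 1) Q := by
  by_cases hc : c.Holds s
  · obtain ⟨s', t, he, ht, hq⟩ := h hc
    exact ⟨s', _, .branchTrue hc he, by omega, hq⟩
  · obtain ⟨s', t, he, ht, hq⟩ := h' hc
    exact ⟨s', _, .branchFalse hc he, by omega, hq⟩

end RunsTo

/-- `for x = 0, …, b - 1 do P`, where the bound is the value of the variable `b`. -/
def Program.forLoop (x b : ℕ) (P : Program) : Program :=
  .seq (.assign x (.const 0))
    (.loop (.lt (.var x) (.var b)) (.seq P (.assign x (.add (.var x) (.const 1)))))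

/-- The invariant rule for counted loops. What the loop does not write keeps its value, so that
the invariant need not mention it. -/
theorem RunsTo.forLoop {x b : ℕ} {P : Program} {s : Memory} {T : ℕ} {Q : Memory → Prop} (N : ℕ)
    (I : ℕ → Memory → Prop) (hxP : P.writesVar x = false) (hbP : P.writesVar b = false)
    (hxb : (b == x) = false) (hN : s.var b = N) (h0 : I 0 (s.setVar x 0))
    (hstep : ∀ i < N, ∀ s', s'.var x = (i : ℤ) → Frame (.forLoop x b P) s s' → I i s' →
      RunsTo P s' T fun s'' => I (i + 1) (s''.setVar x (i + 1)))
    (hend : ∀ s', Frame (.forLoop x b P) s s' → I N s' → Q s') :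
    RunsTo (.forLoop x b P) s (2 + N * (T + 2)) Q := by
  have hfr : ∀ {s' : Memory}, Frame (.forLoop x b P) s s' → s'.var b = N := fun h => by
    rw [← hN]
    exact h.var b (by simpa [Program.forLoop, Program.writesVar, hbP] using hxb)
  have key : ∀ m i, i + m = N → ∀ s', s'.var x = (i : ℤ) → Frame (.forLoop x b P) s s' → I i s' →
      RunsTo (.loop (.lt (.var x) (.var b)) (.seq P (.assign x (.add (.var x) (.const 1))))) s'
        (1 + m * (T + 2)) Q := by
    intro m
    induction m with
    | zero =>
      rintro i rfl s' hx hf hI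
      refine ⟨s', 1, .loopFalse ?_, by omega, hend s' hf hI⟩
      simp [TestExpr.Holds, IntExpr.eval, hx, hfr hf]
    | succ m ih =>
      intro i hi s' hx hf hI
      obtain ⟨s₁, t₁, he₁, ht₁, hI₁⟩ := hstep i (by omega) s' hx hf hI
      have hx₁ : s₁.var x = (i : ℤ) := (he₁.frame.var x hxP).trans hx
      have he₂ : Executes (.seq P (.assign x (.add (.var x) (.const 1)))) s'
          (s₁.setVar x (i + 1)) (t₁ + 1) := by
        have := Executes.assign s₁ x (.add (.var x) (.const 1))
        simp only [IntExpr.eval, hx₁] at this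
        exact .seq he₁ this
      have hf₂ : Frame (.forLoop x b P) s (s₁.setVar x (i + 1)) := by
        refine hf.trans (he₂.frame.of_le ?_ ?_) <;>
          simp +contextual [Program.forLoop, Program.writesVar, Program.writesArr]
      obtain ⟨s₃, t₃, he₃, ht₃, hq⟩ := ih (i + 1) (by omega) (s₁.setVar x (i + 1)) (by simp) hf₂
        (by simpa using hI₁)
      refine ⟨s₃, _, .loopTrue ?_ he₂ he₃, ?_, hq⟩
      · simp only [TestExpr.Holds, IntExpr.eval, hx, hfr hf]
        omega
      · rw [Nat.succ_mul]
        omega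
  refine (RunsTo.assignSeq (key N 0 (by omega) _ ?_ ?_ h0)).mono (by omega) fun _ => id
  · simp [IntExpr.eval]
  · have := (Executes.assign s x (.const 0)).frame
    exact this.of_le (by simp +contextual [Program.forLoop, Program.writesVar])
      (by simp [Program.writesArr])

/-! ### Merging cycles of permutations -/

section Cycles

open Equiv Equiv.Perm

variable {α : Type*}

/-- If `g` agrees with `f` off `K`, then the `f`-orbit of a point is a `g`-orbit until it first
meets `K`. -/
theorem Equiv.Perm.SameCycle.exists_of_eq_off [Finite α] {f g : Perm α} {K : Set α}
    (hfg : ∀ y ∉ K, g y = f y) {y k₀ : α} (h : f.SameCycle y k₀) (hk₀ : k₀ ∈ K) :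
    ∃ k ∈ K, f.SameCycle y k ∧ g.SameCycle y k := by
  obtain ⟨i, hi⟩ := h.exists_nat_pow_eq
  clear h
  induction i generalizing y with
  | zero =>
    obtain rfl : y = k₀ := hi
    exact ⟨y, hk₀, .refl _ _, .refl _ _⟩
  | succ i ih =>
    by_cases hy : y ∈ K
    · exact ⟨y, hy, .refl _ _, .refl _ _⟩
    · obtain ⟨k, hk, h₁, h₂⟩ := ih (y := f y) (by rwa [← Perm.mul_apply, ← pow_succ])
      exact ⟨k, hk, sameCycle_apply_left.1 h₁, sameCycle_apply_left.1 (by rwa [hfg y hy])⟩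

variable [DecidableEq α]

/-- The 3-cycle `r ↦ a ↦ x ↦ r`, for distinct `r`, `a`, `x`. -/
def rot (r a x : α) : Perm α := swap r a * swap a x

theorem rot_left {r a x : α} (hra : r ≠ a) (hrx : r ≠ x) : rot r a x r = a := by
  simp [rot, swap_apply_of_ne_of_ne hra hrx]

theorem rot_mid {r a x : α} (hrx : r ≠ x) (hax : a ≠ x) : rot r a x a = x := by
  simp [rot, swap_apply_of_ne_of_ne hrx.symm hax.symm]

theorem rot_right {r a x : α} : rot r a x x = r := by simp [rot]

theorem rot_of_ne {r a x y : α} (hr : y ≠ r) (ha : y ≠ a) (hx : y ≠ x) : rot r a x y = y := by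
  simp [rot, swap_apply_of_ne_of_ne, *]

theorem mul_rot_eq_off (f : Perm α) (r a x : α) :
    ∀ y ∉ ({r, a, x} : Set α), (f * rot r a x) y = f y := by
  intro y hy
  simp only [Set.mem_insert_iff, Set.mem_singleton_iff, not_or] at hy
  rw [Perm.mul_apply, rot_of_ne hy.1 hy.2.1 hy.2.2]

variable [Fintype α]

theorem Equiv.Perm.SameCycle.exists_pow_lt_card {f : Perm α} {x y : α} (h : f.SameCycle x y) :
    ∃ i < Fintype.card α, (f ^ i) x = y := by
  by_cases hx : x ∈ f.support
  · obtain ⟨i, hi, h⟩ := h.exists_pow_eq_of_mem_support hx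
    exact ⟨i, hi.trans_le (Finset.card_le_univ _), h⟩
  · exact ⟨0, Fintype.card_pos_iff.2 ⟨x⟩, h.eq_of_left (notMem_support.1 hx)⟩

theorem sign_rot {r a x : α} (hra : r ≠ a) (hax : a ≠ x) : sign (rot r a x) = 1 := by
  simp [rot, sign_swap hra, sign_swap hax]

/-- Composition with a 3-cycle on points of three different cycles merges these cycles. -/
theorem sameCycle_mul_rot {f : Perm α} {r a x : α} (hra : ¬ f.SameCycle r a)
    (hrx : ¬ f.SameCycle r x) (hax : ¬ f.SameCycle a x) {y : α}
    (hy : f.SameCycle y r ∨ f.SameCycle y a ∨ f.SameCycle y x) :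
    (f * rot r a x).SameCycle r y := by
  have nra : r ≠ a := by rintro rfl; exact hra (.refl _ _)
  have nrx : r ≠ x := by rintro rfl; exact hrx (.refl _ _)
  have nax : a ≠ x := by rintro rfl; exact hax (.refl _ _)
  have h₁ : (f * rot r a x).SameCycle r a := by
    obtain ⟨k, hk, hf, hg⟩ := SameCycle.exists_of_eq_off (mul_rot_eq_off f r a x)
      (y := f a) (k₀ := a) (by simp [SameCycle.refl]) (by simp)
    rw [sameCycle_apply_left] at hf
    have : f a = (f * rot r a x) r := by rw [Perm.mul_apply, rot_left nra nrx]
    rw [this, sameCycle_apply_left] at hg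
    rcases hk with rfl | rfl | rfl
    exacts [absurd hf.symm hra, hg, absurd hf hax]
  have h₂ : (f * rot r a x).SameCycle a x := by
    obtain ⟨k, hk, hf, hg⟩ := SameCycle.exists_of_eq_off (mul_rot_eq_off f r a x)
      (y := f x) (k₀ := x) (by simp [SameCycle.refl]) (by simp)
    rw [sameCycle_apply_left] at hf
    have : f x = (f * rot r a x) a := by rw [Perm.mul_apply, rot_mid nrx nax]
    rw [this, sameCycle_apply_left] at hg
    rcases hk with rfl | rfl | rfl
    exacts [absurd hf.symm hrx, absurd hf.symm hax, hg]
  have h₃ : ∃ k ∈ ({r, a, x} : Set α), (f * rot r a x).SameCycle y k := by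
    rcases hy with hy | hy | hy <;>
    · obtain ⟨k, hk, -, hg⟩ := hy.exists_of_eq_off (mul_rot_eq_off f r a x) (by simp)
      exact ⟨k, hk, hg⟩
  obtain ⟨k, rfl | rfl | rfl, hk⟩ := h₃
  exacts [hk.symm, h₁.trans hk.symm, h₁.trans (h₂.trans hk.symm)]

theorem isCycle_of_forall_sameCycle {f : Perm α} {r : α} (h2 : 2 ≤ Fintype.card α)
    (h : ∀ y, f.SameCycle r y) : f.IsCycle ∧ f.support = Finset.univ := by
  have hne : ∀ z, f z ≠ z := by
    intro z hz
    obtain ⟨y, hy⟩ := Fintype.exists_ne_of_one_lt_card h2 z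
    exact hy.symm (((h z).symm.trans (h y)).eq_of_left hz)
  exact ⟨⟨r, hne r, fun y _ => h y⟩, by ext z; simp [hne z]⟩

theorem sign_of_forall_sameCycle {f : Perm α} {r : α} (h2 : 2 ≤ Fintype.card α)
    (h : ∀ y, f.SameCycle r y) : sign f = -(-1) ^ Fintype.card α := by
  obtain ⟨h₁, h₃⟩ := isCycle_of_forall_sameCycle h2 h
  rw [h₁.sign, h₃, Finset.card_univ]

/-- A permutation with at most two cycles that has the sign of a full cycle is a full cycle. -/
theorem sameCycle_of_sign_eq {f : Perm α} {r a : α}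
    (hs : sign f = -(-1) ^ Fintype.card α) (h : ∀ y, f.SameCycle y r ∨ f.SameCycle y a) :
    f.SameCycle r a := by
  by_contra hra
  have nra : r ≠ a := by rintro rfl; exact hra (.refl _ _)
  have hoff : ∀ y ∉ ({r, a} : Set α), (f * swap r a) y = f y := by
    intro y hy
    simp only [Set.mem_insert_iff, Set.mem_singleton_iff, not_or] at hy
    rw [Perm.mul_apply, swap_apply_of_ne_of_ne hy.1 hy.2]
  have h₁ : (f * swap r a).SameCycle r a := by
    obtain ⟨k, hk, hf, hg⟩ := SameCycle.exists_of_eq_off hoff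
      (y := f a) (k₀ := a) (by simp [SameCycle.refl]) (by simp)
    rw [sameCycle_apply_left] at hf
    have : f a = (f * swap r a) r := by simp
    rw [this, sameCycle_apply_left] at hg
    rcases hk with rfl | rfl
    exacts [absurd hf.symm hra, hg]
  have h₂ : ∀ y, (f * swap r a).SameCycle r y := by
    intro y
    have h₃ : ∃ k ∈ ({r, a} : Set α), (f * swap r a).SameCycle y k := by
      rcases h y with hy | hy <;>
      · obtain ⟨k, hk, -, hg⟩ := hy.exists_of_eq_off hoff (by simp)
        exact ⟨k, hk, hg⟩
    obtain ⟨k, rfl | rfl, hk⟩ := h₃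
    exacts [hk.symm, h₁.trans hk.symm]
  have h2 : 2 ≤ Fintype.card α := Fintype.one_lt_card_iff.2 ⟨r, a, nra⟩
  have := sign_of_forall_sameCycle h2 h₂
  rw [Perm.sign_mul, sign_swap nra, hs] at this
  rcases Int.units_eq_one_or ((-1) ^ Fintype.card α) with h | h <;> rw [h] at this <;>
    exact absurd this (by decide)

/-- If `f` is a full cycle along which the point `a` does not lie between `x` and `r`, then
composition with the 3-cycle `r ↦ a ↦ x ↦ r` again gives a full cycle. The hypothesis is stated
for the product, where it says that the orbit of `f x` reaches `r`. The product has at most two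
cycles, and its sign, which is that of `f`, excludes exactly two. -/
theorem sameCycle_mul_rot_of_full {f : Perm α} {r a x : α} (hra : r ≠ a) (hrx : r ≠ x)
    (hax : a ≠ x) (hf : ∀ y, f.SameCycle r y) (h : (f * rot r a x).SameCycle (f x) r) (y : α) :
    (f * rot r a x).SameCycle r y := by
  have hxa : f x = (f * rot r a x) a := by rw [Perm.mul_apply, rot_mid hrx hax]
  rw [hxa, sameCycle_apply_left] at h
  have h₁ : ∀ y, (f * rot r a x).SameCycle y r ∨ (f * rot r a x).SameCycle y x := by
    intro y
    obtain ⟨k, hk, -, hg⟩ := (hf y).symm.exists_of_eq_off (mul_rot_eq_off f r a x) (by simp)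
    rcases hk with rfl | rfl | rfl
    exacts [.inl hg, .inl (hg.trans h), .inr hg]
  have h₂ : (f * rot r a x).SameCycle r x := by
    refine sameCycle_of_sign_eq ?_ h₁
    rw [Perm.sign_mul, sign_rot hra hax, mul_one]
    exact sign_of_forall_sameCycle (Fintype.one_lt_card_iff.2 ⟨r, a, hra⟩) hf
  exact (h₁ y).elim SameCycle.symm fun h => h₂.trans h.symm

/-- Two full cycles are conjugate by a permutation that fixes a given point, so that it maps the
orbit of that point under the one step by step to its orbit under the other. -/
theorem exists_conj_of_forall_sameCycle {f g : Perm α} {r : α} (h2 : 2 ≤ Fintype.card α)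
    (hf : ∀ y, f.SameCycle r y) (hg : ∀ y, g.SameCycle r y) :
    ∃ e : Perm α, e * g * e⁻¹ = f ∧ ∀ i : ℕ, e ((g ^ i) r) = (f ^ i) r := by
  obtain ⟨hfc, hfs⟩ := isCycle_of_forall_sameCycle h2 hf
  obtain ⟨hgc, hgs⟩ := isCycle_of_forall_sameCycle h2 hg
  obtain ⟨e, he⟩ := isConj_iff.1 (hgc.isConj hfc (by rw [hfs, hgs]))
  obtain ⟨j, hj⟩ := (hf (e r)).symm.exists_nat_pow_eq
  have he' : f ^ j * e * g * (f ^ j * e)⁻¹ = f :=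
    calc f ^ j * e * g * (f ^ j * e)⁻¹ = f ^ j * (e * g * e⁻¹) * (f ^ j)⁻¹ := by group
      _ = f := by rw [he]; group
  refine ⟨f ^ j * e, he', fun i => ?_⟩
  have h₁ : f ^ i * (f ^ j * e) = f ^ j * e * g ^ i := by
    have h := congrArg (· ^ i) he'
    simp only [conj_pow] at h
    rw [← h, inv_mul_cancel_right]
  rw [← Perm.mul_apply, ← h₁, Perm.mul_apply, Perm.mul_apply (f ^ j), hj]

end Cycles

theorem commutatorElement_eq_of_conj {G : Type*} [Group G] {a b e : G} (h : e * b * e⁻¹ = a) :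
    ⁅a, e⁻¹⁆ = a * b⁻¹ := by
  rw [← h, commutatorElement_def]
  group

/-! ### Braid words and their permutations -/

theorem BraidWord.toBraid_append {n : ℕ} (u v : BraidWord n) :
    BraidWord.toBraid (u ++ v) = u.toBraid * v.toBraid := by
  simp only [BraidWord.toBraid, ← FreeGroup.mul_mk, map_mul]

theorem BraidWord.toBraid_invRev {n : ℕ} (u : BraidWord n) :
    BraidWord.toBraid (FreeGroup.invRev u) = u.toBraid⁻¹ := by
  simp only [BraidWord.toBraid, ← FreeGroup.inv_mk, map_inv]

theorem adjSwap_inv {n : ℕ} (i : Fin (n - 1)) : (adjSwap n i)⁻¹ = adjSwap n i :=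
  Equiv.swap_inv _ _

/-- The permutation of a braid word: the product of the transpositions of its letters,
whatever their signs. -/
def BraidWord.perm {n : ℕ} (w : BraidWord n) : Equiv.Perm (Fin n) :=
  (w.map fun x => adjSwap n x.1).prod

theorem braidToPerm_toBraid {n : ℕ} (w : BraidWord n) : braidToPerm n w.toBraid = w.perm := by
  induction w with
  | nil => exact map_one _
  | cons x w ih =>
    have : BraidWord.toBraid (x :: w) = BraidWord.toBraid [x] * BraidWord.toBraid w :=
      BraidWord.toBraid_append [x] w
    rw [this, map_mul, ih, BraidWord.perm, BraidWord.perm, List.map_cons, List.prod_cons]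
    congr 1
    obtain ⟨i, b⟩ := x
    cases b
    · have : BraidWord.toBraid [(i, false)] = (PresentedGroup.of i : BraidGroup n)⁻¹ := rfl
      rw [this, map_inv, braidToPerm, PresentedGroup.toGroup.of, adjSwap_inv]
    · exact PresentedGroup.toGroup.of _

theorem BraidWord.sign_perm {n : ℕ} {w : BraidWord n}
    (hw : w.toBraid ∈ commutator (BraidGroup n)) : Equiv.Perm.sign w.perm = 1 := by
  have := Abelianization.commutator_subset_ker (Equiv.Perm.sign.comp (braidToPerm n)) hw
  rwa [MonoidHom.mem_ker, MonoidHom.comp_apply, braidToPerm_toBraid] at this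

/-- A positive word as a braid word. -/
def SymWord.positive {n : ℕ} (u : SymWord n) : BraidWord n := u.map fun i => (i, true)

theorem SymWord.toBraid_positive {n : ℕ} (u : SymWord n) :
    u.positive.toBraid = positiveBraid u := by
  induction u with
  | nil => rfl
  | cons i u ih =>
    have : BraidWord.toBraid (SymWord.positive (i :: u)) =
        BraidWord.toBraid [(i, true)] * BraidWord.toBraid (SymWord.positive u) :=
      BraidWord.toBraid_append [(i, true)] _
    rw [this, ih]
    rfl

theorem SymWord.perm_positive {n : ℕ} (u : SymWord n) : u.positive.perm = u.toPerm := by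
  simp [SymWord.positive, BraidWord.perm, SymWord.toPerm, Function.comp_def]

theorem SymWord.code_positive {n : ℕ} (u : SymWord n) : u.positive.code = u.code := by
  simp [SymWord.positive, BraidWord.code, SymWord.code, Function.comp_def]

theorem BraidWord.code_append {n : ℕ} (u v : BraidWord n) :
    BraidWord.code (u ++ v) = u.code ++ v.code := List.map_append

theorem BraidWord.code_invRev {n : ℕ} (u : BraidWord n) :
    BraidWord.code (FreeGroup.invRev u) = (u.code.map Neg.neg).reverse := by
  simp only [BraidWord.code, FreeGroup.invRev, List.map_reverse, List.map_map]
  congr 2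
  funext x
  obtain ⟨i, b⟩ := x
  cases b <;> simp

theorem BraidWord.length_code {n : ℕ} (w : BraidWord n) : w.code.length = w.length :=
  List.length_map _

theorem SymWord.length_code {n : ℕ} (w : SymWord n) : w.code.length = w.length :=
  List.length_map _

/-- `w` followed by the inverse of the commutator of `d₁` and `d₂`. -/
def BraidWord.mulCommutatorInv {n : ℕ} (w d₁ d₂ : BraidWord n) : BraidWord n :=
  w ++ d₂ ++ d₁ ++ FreeGroup.invRev d₂ ++ FreeGroup.invRev d₁

theorem BraidWord.toBraid_mulCommutatorInv {n : ℕ} (w d₁ d₂ : BraidWord n) :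
    (w.mulCommutatorInv d₁ d₂).toBraid = w.toBraid * ⁅d₁.toBraid, d₂.toBraid⁆⁻¹ := by
  simp only [BraidWord.mulCommutatorInv, toBraid_append, toBraid_invRev, commutatorElement_inv]
  simp only [commutatorElement_def, mul_assoc]

/-! ### Words that sort a permutation are permutation braids -/

/-- The left one of the two positions that the `i`-th generator exchanges. -/
abbrev leftPos {n : ℕ} (i : Fin (n - 1)) : Fin n := ⟨i.val, by have := i.isLt; omega⟩

/-- The right one of the two positions that the `i`-th generator exchanges. -/
abbrev rightPos {n : ℕ} (i : Fin (n - 1)) : Fin n := ⟨i.val + 1, by have := i.isLt; omega⟩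

/-- Each letter of the word, applied to the arrangement that the previous letters have made
of `L`, exchanges two adjacent entries that are in the wrong order. -/
def Descends {n : ℕ} : (Fin n → Fin n) → SymWord n → Prop
  | _, [] => True
  | L, i :: w => L (rightPos i) < L (leftPos i) ∧ Descends (fun p => L (adjSwap n i p)) w

theorem descends_concat {n : ℕ} (u : SymWord n) (j : Fin (n - 1)) (L : Fin n → Fin n) :
    Descends L (u ++ [j]) ↔
      Descends L u ∧ L (u.toPerm (rightPos j)) < L (u.toPerm (leftPos j)) := by
  induction u generalizing L with
  | nil => simp [Descends, SymWord.toPerm]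
  | cons i u ih =>
    simp only [List.cons_append, Descends, ih, and_assoc]
    simp [SymWord.toPerm]

/-- The pair `z` of values occurs in the arrangement `L` in the wrong order. -/
def IsInverted {n : ℕ} (L : Fin n → Fin n) (z : Sym2 (Fin n)) : Prop :=
  ∃ p q, p < q ∧ L q < L p ∧ z = s(L p, L q)

theorem adjSwap_lt_or {n : ℕ} (i : Fin (n - 1)) {p q : Fin n} (h : p < q) :
    adjSwap n i p < adjSwap n i q ∨ (p = leftPos i ∧ q = rightPos i) := by
  simp only [adjSwap, Equiv.swap_apply_def, Fin.ext_iff, Fin.lt_def] at h ⊢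
  split_ifs <;> simp_all <;> omega

theorem adjSwap_leftPos {n : ℕ} (i : Fin (n - 1)) : adjSwap n i (leftPos i) = rightPos i :=
  Equiv.swap_apply_left _ _

theorem adjSwap_rightPos {n : ℕ} (i : Fin (n - 1)) : adjSwap n i (rightPos i) = leftPos i :=
  Equiv.swap_apply_right _ _

/-- Exchanging two adjacent entries in the wrong order removes exactly one inversion. -/
theorem IsInverted.of_adjSwap {n : ℕ} {L : Fin n → Fin n} (hL : L.Injective) {i : Fin (n - 1)}
    (hi : L (rightPos i) < L (leftPos i)) {z : Sym2 (Fin n)}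
    (h : IsInverted (fun p => L (adjSwap n i p)) z) :
    IsInverted L z ∧ z ≠ s(L (leftPos i), L (rightPos i)) := by
  obtain ⟨p, q, hpq, hlt, rfl⟩ := h
  have hne : ¬ (p = leftPos i ∧ q = rightPos i) := by
    rintro ⟨rfl, rfl⟩
    simp only [adjSwap_leftPos, adjSwap_rightPos] at hlt
    exact lt_asymm hi hlt
  refine ⟨⟨_, _, (adjSwap_lt_or i hpq).resolve_right hne, hlt, rfl⟩, fun h => ?_⟩
  rcases Sym2.eq_iff.1 h with ⟨h₁, h₂⟩ | ⟨h₁, h₂⟩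
  · have h₁ := hL h₁
    have h₂ := hL h₂
    rw [← adjSwap_rightPos i] at h₁
    rw [← adjSwap_leftPos i] at h₂
    rw [(adjSwap n i).injective h₁, (adjSwap n i).injective h₂, Fin.lt_def] at hpq
    simp at hpq
  · have h₁ := hL h₁
    have h₂ := hL h₂
    rw [← adjSwap_leftPos i] at h₁
    rw [← adjSwap_rightPos i] at h₂
    exact hne ⟨(adjSwap n i).injective h₁, (adjSwap n i).injective h₂⟩

theorem Descends.isInverted {n : ℕ} {L : Fin n → Fin n} {u : SymWord n} (hL : L.Injective)
    (h : Descends L u) : ∀ z ∈ crossingsFrom L u, IsInverted L z := by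
  induction u generalizing L with
  | nil => simp [crossingsFrom]
  | cons i u ih =>
    intro z hz
    rcases List.mem_cons.1 hz with rfl | hz
    · exact ⟨_, _, by simp [Fin.lt_def], h.1, rfl⟩
    · exact (IsInverted.of_adjSwap hL h.1
        (ih (hL.comp (adjSwap n i).injective) h.2 z hz)).1

theorem Descends.nodup_crossingsFrom {n : ℕ} {L : Fin n → Fin n} {u : SymWord n}
    (hL : L.Injective) (h : Descends L u) : (crossingsFrom L u).Nodup := by
  induction u generalizing L with
  | nil => simp [crossingsFrom]
  | cons i u ih =>
    have hL' := hL.comp (adjSwap n i).injective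
    refine List.nodup_cons.2 ⟨fun hz => ?_, ih hL' h.2⟩
    exact (IsInverted.of_adjSwap hL h.1 (Descends.isInverted hL' h.2 _ hz)).2 rfl

theorem crossingsFrom_comp {n : ℕ} (g L : Fin n → Fin n) (u : SymWord n) :
    crossingsFrom (g ∘ L) u = (crossingsFrom L u).map (Sym2.map g) := by
  induction u generalizing L with
  | nil => rfl
  | cons i u ih =>
    simp only [crossingsFrom, List.map_cons]
    exact congrArg _ (ih fun p => L (adjSwap n i p))

theorem Descends.nodup_crossings {n : ℕ} {f : Equiv.Perm (Fin n)} {u : SymWord n}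
    (h : Descends f u) : (crossingsFrom id u).Nodup := by
  have := h.nodup_crossingsFrom f.injective
  rw [← Function.comp_id f, crossingsFrom_comp] at this
  exact this.of_map

theorem length_crossingsFrom {n : ℕ} (L : Fin n → Fin n) (u : SymWord n) :
    (crossingsFrom L u).length = u.length := by
  induction u generalizing L with
  | nil => rfl
  | cons i u ih => simp [crossingsFrom, ih]

theorem Descends.length_le {n : ℕ} {f : Equiv.Perm (Fin n)} {u : SymWord n}
    (h : Descends f u) : u.length ≤ n * n := by
  have := h.nodup_crossings.length_le_card
  rw [length_crossingsFrom, Sym2.card, Fintype.card_fin, Nat.choose_two_right] at this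
  refine this.trans (Nat.div_le_of_le_mul ?_)
  rw [Nat.add_sub_cancel]
  nlinarith [Nat.zero_le n, Nat.le_mul_self n]

theorem Descends.isPermutationBraid {n : ℕ} {f : Equiv.Perm (Fin n)} {u : SymWord n}
    (h : Descends f u) : IsPermutationBraid n u.positive.toBraid :=
  ⟨u, u.toBraid_positive.symm, h.nodup_crossings⟩

/-- Words for `x` and `y` with `⁅x, y⁆ = ρ(w)` yield the decomposition of the braid `w`. -/
theorem isPureBraid_mulCommutatorInv {n : ℕ} {w : BraidWord n} {u₁ u₂ : SymWord n}
    (h : w.perm = ⁅u₁.toPerm, u₂.toPerm⁆) :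
    IsPureBraid n (w.mulCommutatorInv u₁.positive u₂.positive).toBraid := by
  rw [IsPureBraid, MonoidHom.mem_ker, BraidWord.toBraid_mulCommutatorInv, map_mul, map_inv,
    map_commutatorElement]
  simp only [braidToPerm_toBraid, SymWord.perm_positive, h, mul_inv_cancel]

/-! ### Arrays that hold words and maps -/

/-- The array `g` is the table of values of `f`. -/
def Tabulates {n : ℕ} (g : ℤ → ℤ) (f : Fin n → Fin n) : Prop :=
  ∀ i : Fin n, g ((i : ℕ) : ℤ) = ((f i : ℕ) : ℤ)

theorem Tabulates.congr {n : ℕ} {g : ℤ → ℤ} {f f' : Fin n → Fin n} (h : Tabulates g f)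
    (hf : ∀ i, f i = f' i) : Tabulates g f' := fun i => by rw [h i, hf i]

/-- The array `g` begins with the letters of `l`. -/
def HoldsList (g : ℤ → ℤ) (l : List ℤ) : Prop := ∀ i < l.length, g (i : ℤ) = l.getD i 0

theorem HoldsList.concat {g : ℤ → ℤ} {l : List ℤ} (h : HoldsList g l) {m : ℤ}
    (hm : m = l.length) (z : ℤ) : HoldsList (Function.update g m z) (l ++ [z]) := by
  subst hm
  intro i hi
  rw [List.length_append, List.length_singleton] at hi
  rcases Nat.lt_succ_iff_lt_or_eq.1 hi with hi | rfl
  · rw [Function.update_of_ne (by omega), List.getD_append _ _ _ _ hi, h i hi]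
  · simp

/-! ### Sorting -/

/-- The body of the inner loop of the insertion sort of array `L`, which moves the entry at position
`var 5` to its place: the entry has come down to position `var 5 - var 6`, and is exchanged with its
left neighbour if that is larger. For every exchange the number of the corresponding generator is
appended to the word in array `D`, whose length is held in variable `D`. -/
def sortStep (L D : ℕ) : Program :=
  .seq (.assign 7 (.sub (.var 5) (.var 6)))
  (.branch (.lt (.entry L (.var 7)) (.entry L (.sub (.var 7) (.const 1))))
    (.seq (.assign 8 (.entry L (.var 7)))
    (.seq (.store L (.var 7) (.entry L (.sub (.var 7) (.const 1))))
    (.seq (.store L (.sub (.var 7) (.const 1)) (.var 8))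
    (.seq (.store D (.var D) (.var 7))
    (.assign D (.add (.var D) (.const 1)))))))
    .skip)

/-- Insertion sort of the array `L` of length `var 3`, recorded in array `D` as a word. -/
def sortProgram (L D : ℕ) : Program := .forLoop 5 3 (.forLoop 6 5 (sortStep L D))

/-- What the sorting program preserves: array `L` holds the arrangement that the emitted word `u`
makes of the initial arrangement `f`. -/
def SortState {n : ℕ} (f : Equiv.Perm (Fin n)) (L D : ℕ) (s : Memory) (u : SymWord n) : Prop :=
  Descends f u ∧ s.HoldsOutput D u.code ∧ Tabulates (s.arr L) (f * u.toPerm)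

theorem SymWord.toPerm_concat {n : ℕ} (u : SymWord n) (j : Fin (n - 1)) :
    SymWord.toPerm (u ++ [j]) = u.toPerm * adjSwap n j := by
  simp [SymWord.toPerm]

theorem SymWord.code_concat {n : ℕ} (u : SymWord n) (j : Fin (n - 1)) :
    SymWord.code (u ++ [j]) = u.code ++ [(j.val : ℤ) + 1] := by
  simp [SymWord.code]

theorem Tabulates.mul_adjSwap {n : ℕ} {g g' : ℤ → ℤ} {h : Equiv.Perm (Fin n)} (hg : Tabulates g h)
    (j : Fin (n - 1)) (h₁ : g' (j.val + 1) = g j.val) (h₂ : g' j.val = g (j.val + 1))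
    (h₃ : ∀ z : ℤ, z ≠ j.val → z ≠ j.val + 1 → g' z = g z) : Tabulates g' (h * adjSwap n j) := by
  intro p
  rw [Equiv.Perm.mul_apply, ← hg]
  by_cases hl : p = leftPos j
  · subst hl
    rw [adjSwap_leftPos]
    simpa using h₂
  by_cases hr : p = rightPos j
  · subst hr
    rw [adjSwap_rightPos]
    simpa using h₁
  · rw [adjSwap, Equiv.swap_apply_of_ne_of_ne hl hr]
    refine h₃ _ ?_ ?_
    · intro h; exact hl (Fin.ext (by simpa using h))
    · intro h; exact hr (Fin.ext (by simpa using (by exact_mod_cast h)))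

theorem sortStep_runsTo {n : ℕ} {f : Equiv.Perm (Fin n)} {L D : ℕ} (hLD : L ≠ D) (hD : D < 3)
    {s : Memory} {i m : ℕ} (hi : s.var 5 = i) (hm : s.var 6 = m) (hin : i < n) (hmi : m < i)
    {u : SymWord n} (hu : SortState f L D s u)
    (hs : ∀ p q : Fin n, p < q → q.val ≤ i → q.val ≠ i - m →
      (f * u.toPerm) p < (f * u.toPerm) q) :
    RunsTo (sortStep L D) s 7 fun s' => ∃ u, SortState f L D s' u ∧
      ∀ p q : Fin n, p < q → q.val ≤ i → q.val ≠ i - (m + 1) →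
        (f * u.toPerm) p < (f * u.toPerm) q := by
  obtain ⟨hdesc, ⟨hlen, hout⟩, htab⟩ := hu
  obtain ⟨j, hj⟩ : ∃ j : Fin (n - 1), j.val + 1 = i - m := ⟨⟨i - m - 1, by omega⟩, by simp; omega⟩
  have hj' : (i : ℤ) - m = j.val + 1 := by omega
  have hl := htab (leftPos j)
  have hr := htab (rightPos j)
  simp only [Nat.cast_add, Nat.cast_one] at hl hr
  have hD5 : (5 = D) = False := by simp; omega
  have hD7 : (7 = D) = False := by simp; omega
  have hD7' : (D = 7) = False := by simp; omega
  have hD8' : (D = 8) = False := by simp; omega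
  have hmono : ∀ p q : Fin n, p < q → q.val ≤ i → q ≠ rightPos j →
      (f * u.toPerm) p < (f * u.toPerm) q := fun p q hpq hq hne =>
    hs p q hpq hq fun h => hne (Fin.ext (by simp [h, hj]))
  refine (RunsTo.assignSeq (RunsTo.branch (T := 5) (T' := 1) (fun hc => ?_)
    fun hc => .skip ?_)).mono (by decide) fun _ => id
  · simp only [TestExpr.Holds, IntExpr.eval, Memory.setVar_var, Memory.setVar_arr, hi, hm, hj',
      if_true, add_sub_cancel_right, hl, hr] at hc
    have hlt : (f * u.toPerm) (rightPos j) < (f * u.toPerm) (leftPos j) := by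
      rw [Fin.lt_def]; exact_mod_cast hc
    refine RunsTo.assignSeq (.storeSeq (.storeSeq (.storeSeq (.assign
      ⟨u ++ [j], ⟨?_, ⟨?_, ?_⟩, ?_⟩, ?_⟩))))
    · rw [descends_concat]
      exact ⟨hdesc, hlt⟩
    · simp [IntExpr.eval, SymWord.code_concat, hD7', hD8', hlen]
    · have := HoldsList.concat (g := s.arr D) hout hlen ((j.val : ℤ) + 1)
      rw [← SymWord.code_concat] at this
      simpa [HoldsList, IntExpr.eval, hLD.symm, hD7', hD8', hi, hm, hj'] using this
    · rw [SymWord.toPerm_concat, ← mul_assoc]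
      refine htab.mul_adjSwap j ?_ ?_ ?_
      · simp [IntExpr.eval, hLD, hi, hm, hj']
      · simp [IntExpr.eval, hLD, hi, hm, hj']
      · intro z h₁ h₂
        simp [IntExpr.eval, hLD, hi, hm, hj', h₁, h₂]
    · intro p q hpq hq hne
      rw [SymWord.toPerm_concat, ← mul_assoc, Equiv.Perm.mul_apply _ (adjSwap n j),
        Equiv.Perm.mul_apply _ (adjSwap n j)]
      rcases adjSwap_lt_or j hpq with h | ⟨rfl, rfl⟩
      · refine hmono _ _ h ?_ ?_
        · by_cases h₁ : q = leftPos j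
          · subst h₁; rw [adjSwap_leftPos]; simp; omega
          by_cases h₂ : q = rightPos j
          · subst h₂; rw [adjSwap_rightPos]; simp; omega
          · rwa [adjSwap, Equiv.swap_apply_of_ne_of_ne h₁ h₂]
        · rw [← adjSwap_leftPos j]
          intro h
          have := (adjSwap n j).injective h
          subst this
          exact hne (by simp; omega)
      · rw [adjSwap_leftPos, adjSwap_rightPos]
        exact hlt
  · simp only [TestExpr.Holds, IntExpr.eval, Memory.setVar_var, Memory.setVar_arr, hi, hm, hj',
      if_true, add_sub_cancel_right, hl, hr] at hc
    have hle : (f * u.toPerm) (leftPos j) ≤ (f * u.toPerm) (rightPos j) := by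
      rw [Fin.le_def]; exact_mod_cast not_lt.1 hc
    have hlt : (f * u.toPerm) (leftPos j) < (f * u.toPerm) (rightPos j) :=
      lt_of_le_of_ne hle fun h => by simpa using (f * u.toPerm).injective h
    refine ⟨u, ⟨hdesc, ⟨?_, ?_⟩, ?_⟩, ?_⟩
    · simpa [hD7'] using hlen
    · simpa using hout
    · simpa using htab
    · intro p q hpq hq hne
      by_cases h : q = rightPos j
      · subst h
        rcases lt_or_eq_of_le (show p ≤ leftPos j by
          rw [Fin.lt_def] at hpq; rw [Fin.le_def]; simp at hpq ⊢; omega) with h | rfl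
        · exact (hmono _ _ h (by simp; omega) (by simp)).trans hlt
        · exact hlt
      · exact hmono p q hpq hq h

theorem writesVar_sortStep {L D : ℕ} {x : ℕ} (hD : x ≠ D) (h7 : x ≠ 7) (h8 : x ≠ 8) :
    (sortStep L D).writesVar x = false := by
  simp [sortStep, Program.writesVar, *]

theorem SortState.setVar {n : ℕ} {f : Equiv.Perm (Fin n)} {L D : ℕ} {s : Memory} {u : SymWord n}
    (h : SortState f L D s u) {x : ℕ} (hx : D ≠ x) (z : ℤ) : SortState f L D (s.setVar x z) u :=
  ⟨h.1, ⟨by simpa [hx] using h.2.1.1, h.2.1.2⟩, h.2.2⟩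

theorem sortProgram_runsTo {n : ℕ} {f : Equiv.Perm (Fin n)} {L D : ℕ} (hLD : L ≠ D) (hD : D < 3)
    {s : Memory} (hn : s.var 3 = n) (hlen : s.var D = 0) (hf : Tabulates (s.arr L) f) :
    RunsTo (sortProgram L D) s (2 + n * (2 + n * 9 + 2)) fun s' =>
      ∃ u : SymWord n, Descends f u ∧ f * u.toPerm = 1 ∧ s'.HoldsOutput D u.code := by
  have hD' : D ≠ 5 ∧ D ≠ 6 ∧ D ≠ 7 ∧ D ≠ 8 ∧ D ≠ 3 := by omega
  refine RunsTo.forLoop n (fun i s' => ∃ u, SortState f L D s' u ∧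
    ∀ p q : Fin n, p < q → q.val < i → (f * u.toPerm) p < (f * u.toPerm) q) ?_ ?_ rfl hn ?_ ?_ ?_
  · simp [Program.forLoop, Program.writesVar, sortStep, hD'.1.symm]
  · simp [Program.forLoop, Program.writesVar, sortStep, hD'.2.2.2.2.symm]
  · exact ⟨[], ⟨trivial, ⟨by simpa [hD', SymWord.code] using hlen, by simp [SymWord.code]⟩, hf⟩,
      by simp⟩
  · rintro i hi s₁ h5 hfr ⟨u₀, hu₀, hs₀⟩
    refine (RunsTo.forLoop (T := 7) i (fun m s' => ∃ u, SortState f L D s' u ∧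
      ∀ p q : Fin n, p < q → q.val ≤ i → q.val ≠ i - m →
        (f * u.toPerm) p < (f * u.toPerm) q)
      (writesVar_sortStep hD'.2.1.symm (by decide) (by decide))
      (writesVar_sortStep hD'.1.symm (by decide) (by decide)) rfl h5 ?_ ?_ ?_).mono ?_
      fun _ => id
    · exact ⟨u₀, hu₀.setVar hD'.2.1 _, fun p q hpq hq hne => hs₀ p q hpq (by omega)⟩
    · rintro m hm s₂ h6 hfr₂ ⟨u, hu, hs⟩
      have h5' : s₂.var 5 = i := by
        rw [← h5]
        exact hfr₂.var 5 (by simp [Program.forLoop, Program.writesVar, sortStep, hD'.1.symm])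
      refine (sortStep_runsTo hLD hD h5' h6 hi hm hu hs).mono le_rfl ?_
      rintro s₃ ⟨u, hu, hs⟩
      exact ⟨u, hu.setVar hD'.2.1 _, hs⟩
    · rintro s₂ hfr₂ ⟨u, hu, hs⟩
      refine ⟨u, hu.setVar hD'.1 _, fun p q hpq hq => hs p q hpq (by omega) ?_⟩
      rw [Fin.lt_def] at hpq
      omega
    · gcongr
  · rintro s₁ - ⟨u, ⟨hd, ho, -⟩, hs⟩
    refine ⟨u, hd, ?_, ho⟩
    have hmono : StrictMono (f * u.toPerm) := fun p q hpq => hs p q hpq q.isLt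
    ext p : 1
    exact congrFun hmono.eq_id p

/-! ### Computing the permutation of a braid word -/

/-- Exchanges the entries of array `3` that the letter at position `var 5` of array `0` names. -/
def letterStep : Program :=
  .seq (.assign 7 (.entry 0 (.var 5)))
  (.seq (.branch (.lt (.var 7) (.const 0)) (.assign 7 (.sub (.const 0) (.var 7))) .skip)
  (.seq (.assign 8 (.entry 3 (.var 7)))
  (.seq (.store 3 (.var 7) (.entry 3 (.sub (.var 7) (.const 1))))
  (.store 3 (.sub (.var 7) (.const 1)) (.var 8)))))

/-- Computes in array `3` the permutation of the braid word in array `0`, of length `var 4`. -/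
def permProgram : Program :=
  .seq (.forLoop 5 3 (.store 3 (.var 5) (.var 5))) (.forLoop 5 4 letterStep)

theorem letterStep_runsTo {n : ℕ} {h : Equiv.Perm (Fin n)} {s : Memory} {i : ℕ}
    (hi : s.var 5 = i) (x : Fin (n - 1) × Bool)
    (hx : s.arr 0 i = if x.2 then (x.1.val : ℤ) + 1 else -((x.1.val : ℤ) + 1))
    (hh : Tabulates (s.arr 3) h) :
    RunsTo letterStep s 6 fun s' => Tabulates (s'.arr 3) (h * adjSwap n x.1) := by
  obtain ⟨j, b⟩ := x
  have key : RunsTo (.branch (.lt (.var 7) (.const 0)) (.assign 7 (.sub (.const 0) (.var 7))) .skip)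
      (s.setVar 7 (IntExpr.eval s (.entry 0 (.var 5)))) 2
      (fun s' => s'.var 7 = j.val + 1 ∧ s'.arr = s.arr) := by
    refine RunsTo.branch (T := 1) (T' := 1) (fun hc => .assign ?_) (fun hc => .skip ?_) <;>
      cases b <;> simp [TestExpr.Holds, IntExpr.eval, hi, hx] at hc ⊢ <;> omega
  refine (RunsTo.assignSeq (.seq (T' := 3) (key.mono le_rfl ?_))).mono le_rfl fun _ => id
  rintro s₁ ⟨h7, harr⟩
  refine .assignSeq (.storeSeq (.store ?_))
  refine hh.mul_adjSwap j ?_ ?_ ?_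
  · simp [IntExpr.eval, h7, harr]
  · simp [IntExpr.eval, h7, harr]
  · intro z h₁ h₂
    simp [IntExpr.eval, h7, harr, h₁, h₂]

theorem BraidWord.perm_concat {n : ℕ} (w : BraidWord n) (x : Fin (n - 1) × Bool) :
    BraidWord.perm (w ++ [x]) = w.perm * adjSwap n x.1 := by
  simp [BraidWord.perm]

theorem permProgram_runsTo {n : ℕ} (w : BraidWord n) {s : Memory} (hn : s.var 3 = n)
    (hk : s.var 4 = w.length) (hw : HoldsList (s.arr 0) w.code) :
    RunsTo permProgram s ((2 + n * 3) + (2 + w.length * 8)) fun s' =>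
      Tabulates (s'.arr 3) w.perm := by
  refine .seq (RunsTo.mono (RunsTo.frame (RunsTo.forLoop n
    (fun i s' => ∀ p : Fin n, p.val < i → s'.arr 3 p.val = p.val)
    (Q := fun s' => Tabulates (s'.arr 3) (1 : Equiv.Perm (Fin n)))
    rfl rfl rfl hn ?_ ?_ ?_)) le_rfl ?_)
  · simp
  · intro i hi s₁ h5 _ hI
    refine .store fun p hp => ?_
    by_cases h : p.val = i
    · simp [IntExpr.eval, h5, h]
    · simpa [IntExpr.eval, h5, h] using hI p (by omega)
  · exact fun s₁ _ hI p => hI p p.isLt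
  rintro s₁ ⟨h3, hfr⟩
  refine RunsTo.forLoop w.length
    (fun i s' => Tabulates (s'.arr 3) (BraidWord.perm (w.take i)))
    rfl rfl rfl ((hfr.var 4 rfl).trans hk) ?_ ?_ ?_
  · simpa [BraidWord.perm] using h3
  · intro i hi s₂ h5 hfr₂ hI
    have h0 : s₂.arr 0 = s.arr 0 := (hfr₂.arr 0 rfl).trans (hfr.arr 0 rfl)
    refine (letterStep_runsTo h5 w[i] ?_ hI).mono le_rfl ?_
    · rw [h0, hw i (by rwa [BraidWord.length_code])]
      simp [BraidWord.code, List.getD_eq_getElem?_getD, List.getElem?_eq_getElem hi]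
    · intro s₃ h
      rw [Memory.setVar_arr, List.take_succ_eq_append_getElem hi, BraidWord.perm_concat]
      exact h
  · intro s₂ _ hI
    rwa [List.take_length] at hI

/-! ### Writing an even permutation as a quotient of two full cycles -/

/-- Array `5` becomes the cycle `y ↦ y + 1`, and array `4` its product with array `3`. -/
def initProgram : Program :=
  .seq (.forLoop 5 3
    (.seq (.store 4 (.var 5) (.entry 3 (.add (.var 5) (.const 1))))
      (.store 5 (.var 5) (.add (.var 5) (.const 1)))))
  (.seq (.store 4 (.sub (.var 3) (.const 1)) (.entry 3 (.const 0)))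
    (.store 5 (.sub (.var 3) (.const 1)) (.const 0)))

theorem val_finRotate {n : ℕ} (y : Fin n) :
    (finRotate n y).val = if y.val + 1 = n then 0 else y.val + 1 := by
  cases n with
  | zero => exact y.elim0
  | succ n =>
    split_ifs with h
    · have : y = Fin.last n := Fin.ext (by simpa using h)
      simp [this]
    · exact coe_finRotate_of_ne_last fun h' => h (by simp [h'])

theorem initProgram_runsTo {n : ℕ} [NeZero n] {f : Equiv.Perm (Fin n)} {s : Memory}
    (hn : s.var 3 = n) (hf : Tabulates (s.arr 3) f) :
    RunsTo initProgram s ((2 + n * 4) + 2) fun s' =>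
      Tabulates (s'.arr 4) (f * finRotate n) ∧ Tabulates (s'.arr 5) (finRotate n) := by
  refine .seq (RunsTo.mono (RunsTo.frame (RunsTo.forLoop n
    (fun i s' => ∀ p : ℕ, p < i → s'.arr 4 p = s.arr 3 (p + 1) ∧ s'.arr 5 p = p + 1)
    (Q := fun s' => ∀ p : ℕ, p < n → s'.arr 4 p = s.arr 3 (p + 1) ∧ s'.arr 5 p = p + 1)
    rfl rfl rfl hn ?_ ?_ ?_)) le_rfl ?_)
  · simp
  · intro i hi s₁ h5 hfr hI
    have h3 := hfr.arr 3 rfl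
    refine .storeSeq (.store fun p hp => ?_)
    by_cases h : p = i
    · simp [IntExpr.eval, h5, h, h3]
    · simpa [IntExpr.eval, h5, h] using hI p (by omega)
  · exact fun s₁ _ hI p => hI p
  rintro s₁ ⟨hI, hfr⟩
  have h3 := hfr.arr 3 rfl
  have hv := (hfr.var 3 rfl).trans hn
  refine .storeSeq (.store ?_)
  have hval := val_finRotate (n := n)
  constructor
  · intro p
    rw [Equiv.Perm.mul_apply, ← hf, hval]
    by_cases h : p.val + 1 = n
    · have h' : (p.val : ℤ) = n - 1 := by omega
      simp [IntExpr.eval, hv, h, h', h3]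
    · have h' : (p.val : ℤ) ≠ n - 1 := by omega
      simp [IntExpr.eval, hv, h, h', (hI p p.isLt).1]
  · intro p
    rw [hval]
    by_cases h : p.val + 1 = n
    · have h' : (p.val : ℤ) = n - 1 := by omega
      simp [IntExpr.eval, hv, h, h']
    · have h' : (p.val : ℤ) ≠ n - 1 := by omega
      simp [IntExpr.eval, hv, h, h', (hI p p.isLt).2]

/-- Sets the flag `var 11` if the point `var 5` is in the cycle of `0` or of `var 10` under
array `4`. The two cycles are traversed by `var 8` and `var 9`. -/
def searchProgram : Program :=
  .seq (.assign 8 (.const 0)) (.seq (.assign 9 (.var 10)) (.seq (.assign 11 (.const 0))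
    (.forLoop 6 3
      (.seq (.branch (.eq (.var 8) (.var 5)) (.assign 11 (.const 1)) .skip)
      (.seq (.branch (.eq (.var 9) (.var 5)) (.assign 11 (.const 1)) .skip)
      (.seq (.assign 8 (.entry 4 (.var 8))) (.assign 9 (.entry 4 (.var 9)))))))))

theorem searchProgram_runsTo {n : ℕ} [NeZero n] {A : Equiv.Perm (Fin n)} {a x : Fin n}
    {s : Memory} (hn : s.var 3 = n) (hA : Tabulates (s.arr 4) A) (ha : s.var 10 = a.val)
    (hx : s.var 5 = x.val) :
    RunsTo searchProgram s (5 + n * 8) fun s' =>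
      (s'.var 11 = 0 ↔ ¬ (A.SameCycle x 0 ∨ A.SameCycle x a)) := by
  let I : ℕ → Memory → Prop := fun i s' =>
    s'.var 8 = ((A ^ i) 0).val ∧ s'.var 9 = ((A ^ i) a).val ∧
      (s'.var 11 = 0 ↔ ∀ j < i, (A ^ j) 0 ≠ x ∧ (A ^ j) a ≠ x)
  refine (RunsTo.assignSeq (.assignSeq (.assignSeq
    (RunsTo.forLoop (T := 6) n I rfl rfl rfl ?_ ?_ ?_ ?_)))).mono
    (T := 1 + (1 + (1 + (2 + n * (6 + 2))))) (by omega) fun _ => id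
  · simpa using hn
  · simp [I, IntExpr.eval, ha]
  · rintro i hi s₁ - hfr ⟨h8, h9, h11⟩
    have h5 : s₁.var 5 = x.val := (hfr.var 5 rfl).trans (by simpa using hx)
    have h4 : s₁.arr 4 = s.arr 4 := hfr.arr 4 rfl
    have e8 : s₁.var 8 = s₁.var 5 ↔ (A ^ i) 0 = x := by rw [h8, h5, Fin.ext_iff, Nat.cast_inj]
    have e9 : s₁.var 9 = s₁.var 5 ↔ (A ^ i) a = x := by rw [h9, h5, Fin.ext_iff, Nat.cast_inj]
    have hA8 : s₁.arr 4 (s₁.var 8) = ((A ^ (i + 1)) 0).val := by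
      rw [h4, h8, hA, pow_succ', Equiv.Perm.mul_apply]
    have hA9 : s₁.arr 4 (s₁.var 9) = ((A ^ (i + 1)) a).val := by
      rw [h4, h9, hA, pow_succ', Equiv.Perm.mul_apply]
    simp only [Nat.forall_lt_succ_right, I]
    refine (RunsTo.seq (T := 2) (T' := 4) (.branch (T := 1) (T' := 1) (fun c => .assign ?_)
      fun c => .skip ?_)) <;>
    refine (RunsTo.seq (T := 2) (T' := 2) (.branch (T := 1) (T' := 1) (fun c' => .assign ?_)
      fun c' => .skip ?_)) <;>
    refine .assignSeq (.assign ?_) <;>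
    simp_all [TestExpr.Holds, IntExpr.eval]
  · rintro s₁ - ⟨-, -, h11⟩
    rw [h11, not_or]
    constructor
    · intro h
      constructor <;> intro hc <;> obtain ⟨j, hj, hc⟩ := hc.symm.exists_pow_lt_card <;>
        rw [Fintype.card_fin] at hj
      exacts [(h j hj).1 hc, (h j hj).2 hc]
    · refine fun h j _ => ⟨?_, ?_⟩ <;> rintro rfl
      · exact h.1 (Equiv.Perm.sameCycle_pow_left.2 (.refl _ _))
      · exact h.2 (Equiv.Perm.sameCycle_pow_left.2 (.refl _ _))

/-- Permutes the entries of array `M` at the positions `0`, `var 10`, `var 5` cyclically. -/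
def rotateProgram (M : ℕ) : Program :=
  .seq (.assign 8 (.entry M (.const 0)))
  (.seq (.store M (.const 0) (.entry M (.var 10)))
  (.seq (.store M (.var 10) (.entry M (.var 5)))
  (.store M (.var 5) (.var 8))))

theorem rotateProgram_runsTo {n : ℕ} [NeZero n] {A : Equiv.Perm (Fin n)} {a x : Fin n} {M : ℕ}
    {s : Memory} (hA : Tabulates (s.arr M) A) (ha : s.var 10 = a.val)
    (hx : s.var 5 = x.val) (h0a : 0 ≠ a) (h0x : 0 ≠ x) (hax : a ≠ x) :
    RunsTo (rotateProgram M) s 4 fun s' => Tabulates (s'.arr M) (A * rot 0 a x) := by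
  refine .assignSeq (.storeSeq (.storeSeq (.store fun p => ?_)))
  have h0 : ((0 : Fin n).val : ℤ) = 0 := by simp
  have hA0 : s.arr M 0 = _ := h0 ▸ hA 0
  have e1 : (a.val : ℤ) ≠ 0 := fun h => h0a (Fin.ext (by simpa using h) : a = 0).symm
  have e2 : (x.val : ℤ) ≠ 0 := fun h => h0x (Fin.ext (by simpa using h) : x = 0).symm
  have e3 : (x.val : ℤ) ≠ a.val := fun h => hax (Fin.ext (by simpa using h.symm))
  rw [Equiv.Perm.mul_apply]
  by_cases hp0 : p = 0
  · subst hp0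
    rw [rot_left h0a h0x, ← hA]
    simp [IntExpr.eval, ha, hx, e1.symm, e2.symm]
  have f0 : (p.val : ℤ) ≠ 0 := fun h => hp0 (Fin.ext (by simpa using h))
  by_cases hpa : p = a
  · subst hpa
    rw [rot_mid h0x hax, ← hA]
    simp [IntExpr.eval, ha, hx, e3.symm, h0x.symm]
  by_cases hpx : p = x
  · subst hpx
    rw [rot_right]
    simp [IntExpr.eval, hx, hA0]
  have fa : (p.val : ℤ) ≠ a.val := fun h => hpa (Fin.ext (by simpa using h))
  have fx : (p.val : ℤ) ≠ x.val := fun h => hpx (Fin.ext (by simpa using h))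
  rw [rot_of_ne hp0 hpa hpx, ← hA]
  simp [IntExpr.eval, ha, hx, hp0, fa, fx, Function.update_apply]

/-- Processes the point `var 5`. If its cycle under array `4` is neither that of `0` nor that of
the waiting point `var 10`, then it becomes the waiting point if there is none (if `var 10` is
`0`), and otherwise the three cycles are merged. -/
def mergeStep : Program :=
  .seq searchProgram
  (.branch (.eq (.var 11) (.const 0))
    (.branch (.eq (.var 10) (.const 0)) (.assign 10 (.var 5))
      (.seq (rotateProgram 4) (.seq (rotateProgram 5) (.assign 10 (.const 0)))))
    .skip)

/-- The invariant after the points below `x` have been processed: arrays `4` and `5` hold `A` and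
`B` with `A * B⁻¹ = f`, and `B` is a full cycle that maps every `y ≥ x` to `y + 1`. The points
below `x` are in the cycle of `0` or of `a` under `A`, where `a = 0` means that no point waits. -/
structure MergeState {n : ℕ} [NeZero n] (f : Equiv.Perm (Fin n)) (x : ℕ) (s : Memory)
    (A B : Equiv.Perm (Fin n)) (a : Fin n) : Prop where
  tabA : Tabulates (s.arr 4) A
  tabB : Tabulates (s.arr 5) B
  var_a : s.var 10 = a.val
  quot : A * B⁻¹ = f
  full : ∀ y, B.SameCycle 0 y
  tail : ∀ y : Fin n, x ≤ y.val → (B y).val = if y.val + 1 = n then 0 else y.val + 1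
  waiting : a = 0 ∨ ¬ A.SameCycle 0 a ∧ a.val < x
  merged : ∀ y : Fin n, y.val < x → A.SameCycle y 0 ∨ A.SameCycle y a

/-- If `B` maps every `y ≥ x` to `y + 1`, then the 3-cycle `0 ↦ a ↦ x ↦ 0`, for `a < x`, has the
orientation for which the product is a full cycle again. -/
theorem sameCycle_mul_rot_of_tail {n : ℕ} [NeZero n] {B : Equiv.Perm (Fin n)} {a x : Fin n}
    (h0a : 0 ≠ a) (hax : a < x) (hB : ∀ y, B.SameCycle 0 y)
    (tail : ∀ y : Fin n, x ≤ y → (B y).val = if y.val + 1 = n then 0 else y.val + 1) (y : Fin n) :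
    (B * rot 0 a x).SameCycle 0 y := by
  have h0x : 0 ≠ x := by
    rintro rfl
    simp at hax
  -- From any point above `x`, the product walks up to the last point and then to `0`.
  have key : ∀ m : ℕ, ∀ y : Fin n, x < y → y.val + m = n - 1 →
      (B * rot 0 a x).SameCycle y 0 := by
    intro m
    induction m with
    | zero =>
      intro y hy hm
      have h₁ : (B * rot 0 a x) y = 0 := by
        rw [Equiv.Perm.mul_apply, rot_of_ne (by rintro rfl; simp at hy)
          (hax.trans hy).ne' hy.ne']
        exact Fin.ext (by rw [tail y hy.le, if_pos (by omega)]; simp)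
      rw [← Equiv.Perm.sameCycle_apply_left, h₁]
    | succ m ih =>
      intro y hy hm
      have h₁ : (B * rot 0 a x) y = B y := by
        rw [Equiv.Perm.mul_apply, rot_of_ne (by rintro rfl; simp at hy)
          (hax.trans hy).ne' hy.ne']
      have h₂ : (B y).val = y.val + 1 := by rw [tail y hy.le, if_neg (by omega)]
      rw [← Equiv.Perm.sameCycle_apply_left, h₁]
      exact ih _ (by rw [Fin.lt_def] at hy ⊢; omega) (by omega)
  refine sameCycle_mul_rot_of_full h0a h0x hax.ne hB ?_ y
  have h₁ := tail x le_rfl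
  split_ifs at h₁ with h
  · have : B x = 0 := Fin.ext (by simpa using h₁)
    rw [this]
  · exact key (n - 1 - (x.val + 1)) _ (by rw [Fin.lt_def]; omega) (by omega)

theorem mergeStep_runsTo {n : ℕ} [NeZero n] {f : Equiv.Perm (Fin n)} {x : Fin n} {s : Memory}
    (hn : s.var 3 = n) (hx : s.var 5 = x.val)
    (h : ∃ A B a, MergeState f x.val s A B a) :
    RunsTo mergeStep s (5 + n * 8 + 11) fun s' =>
      ∃ A B a, MergeState f (x.val + 1) s' A B a := by
  obtain ⟨A, B, a, tabA, tabB, var_a, quot, full, tail, waiting, merged⟩ := h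
  have tail' : ∀ y : Fin n, x.val + 1 ≤ y.val →
      (B y).val = if y.val + 1 = n then 0 else y.val + 1 := fun y hy => tail y (by omega)
  refine .seq ((searchProgram_runsTo hn tabA var_a hx).frame.mono le_rfl ?_)
  rintro s₁ ⟨h11, hfr⟩
  rw [← hfr.arr 4 rfl] at tabA
  rw [← hfr.arr 5 rfl] at tabB
  rw [← hfr.var 10 rfl] at var_a
  rw [← hfr.var 5 rfl] at hx
  have hsplit : ∀ y : Fin n, y.val < x.val + 1 → y.val < x.val ∨ y = x := fun y hy =>
    (Nat.lt_succ_iff_lt_or_eq.1 hy).imp id Fin.ext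
  refine .branch (T := 10) (T' := 1) (fun c => ?_) fun c => .skip ?_
  · have hnot := h11.1 c
    rw [not_or] at hnot
    have h0x : 0 ≠ x := by rintro rfl; exact hnot.1 (.refl _ _)
    refine .branch (T := 1) (T' := 4 + (4 + 1)) (fun c' => .assign ?_) fun c' => ?_
    · have ha0 : a = 0 := by
        simp only [TestExpr.Holds, IntExpr.eval, var_a] at c'
        exact Fin.ext (by simpa using c')
      subst ha0
      refine ⟨A, B, x, tabA, tabB, by simpa [IntExpr.eval] using hx, quot, full, tail',
        .inr ⟨fun h => hnot.1 h.symm, by omega⟩, fun y hy => ?_⟩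
      rcases hsplit y hy with hy | rfl
      · exact .inl ((merged y hy).elim id id)
      · exact .inr (.refl _ _)
    · have ha0 : a ≠ 0 := by
        rintro rfl
        exact c' (by simp [TestExpr.Holds, IntExpr.eval, var_a])
      obtain ⟨hna, hax⟩ := waiting.resolve_left ha0
      refine .seq ((rotateProgram_runsTo tabA var_a hx ha0.symm h0x
        (Fin.ne_of_lt hax)).frame.mono le_rfl ?_)
      rintro s₂ ⟨tabA', hfr₂⟩
      rw [← hfr₂.arr 5 rfl] at tabB
      rw [← hfr₂.var 10 rfl] at var_a
      rw [← hfr₂.var 5 rfl] at hx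
      refine .seq ((rotateProgram_runsTo tabB var_a hx ha0.symm h0x
        (Fin.ne_of_lt hax)).frame.mono le_rfl ?_)
      rintro s₃ ⟨tabB', hfr₃⟩
      rw [← hfr₃.arr 4 rfl] at tabA'
      refine .assign ⟨A * rot 0 a x, B * rot 0 a x, 0, tabA', tabB', by simp [IntExpr.eval], ?_,
        sameCycle_mul_rot_of_tail ha0.symm hax full tail, fun y hy => ?_, .inl rfl,
        fun y hy => .inl (sameCycle_mul_rot hna (fun h => hnot.1 h.symm)
          (fun h => hnot.2 h.symm) ?_).symm⟩
      · rw [← quot]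
        group
      · rw [Equiv.Perm.mul_apply, rot_of_ne, tail' y hy]
        · rintro rfl
          simp at hy
        · rintro rfl
          omega
        · rintro rfl
          omega
      · rcases hsplit y hy with hy | rfl
        · exact (merged y hy).imp id .inl
        · exact .inr (.inr (.refl _ _))
  · refine ⟨A, B, a, tabA, tabB, var_a, quot, full, tail', waiting.imp id fun h => ⟨h.1, by omega⟩,
      fun y hy => ?_⟩
    rcases hsplit y hy with hy | rfl
    · exact merged y hy
    · exact not_not.1 fun h => c (h11.2 h)

/-- Processes all points. -/
def mergeProgram : Program := .seq (.assign 10 (.const 0)) (.forLoop 5 3 mergeStep)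

theorem mergeProgram_runsTo {n : ℕ} [NeZero n] (h2 : 2 ≤ n) {f : Equiv.Perm (Fin n)}
    (hf : Equiv.Perm.sign f = 1) {s : Memory} (hn : s.var 3 = n)
    (hA : Tabulates (s.arr 4) (f * finRotate n)) (hB : Tabulates (s.arr 5) (finRotate n)) :
    RunsTo mergeProgram s (1 + (2 + n * (5 + n * 8 + 11 + 2))) fun s' =>
      ∃ A B : Equiv.Perm (Fin n), Tabulates (s'.arr 4) A ∧ Tabulates (s'.arr 5) B ∧
        A * B⁻¹ = f ∧ (∀ y, A.SameCycle 0 y) ∧ ∀ y, B.SameCycle 0 y := by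
  refine .assignSeq (RunsTo.forLoop n (fun x s' => ∃ A B a, MergeState f x s' A B a)
    rfl rfl rfl (by simpa using hn) ?_ ?_ ?_)
  · refine ⟨f * finRotate n, finRotate n, 0, hA, hB, by simp [IntExpr.eval], by group, ?_,
      fun y _ => val_finRotate y, .inl rfl, by simp⟩
    obtain ⟨m, rfl⟩ := Nat.exists_eq_add_of_le' h2
    intro y
    refine (isCycle_finRotate (n := m)).sameCycle ?_ ?_ <;>
      rw [← Equiv.Perm.mem_support, support_finRotate] <;> simp
  · rintro x hx s₁ h5 hfr ⟨A, B, a, h⟩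
    refine (mergeStep_runsTo (x := ⟨x, hx⟩) ((hfr.var 3 rfl).trans hn) h5
      ⟨A, B, a, h⟩).mono le_rfl ?_
    rintro s₂ ⟨A, B, a, h⟩
    exact ⟨A, B, a, h.tabA, h.tabB, by simpa using h.var_a, h.quot, h.full, h.tail, h.waiting,
      h.merged⟩
  · rintro s₁ - ⟨A, B, a, tabA, tabB, -, quot, full, -, waiting, merged⟩
    refine ⟨A, B, tabA, tabB, quot, ?_, full⟩
    have hsign : Equiv.Perm.sign A = -(-1) ^ Fintype.card (Fin n) := by
      rw [← sign_of_forall_sameCycle (by simpa using h2) full, ← inv_mul_cancel_right A B, quot,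
        Equiv.Perm.sign_mul, hf, one_mul]
    have h0a := sameCycle_of_sign_eq hsign fun y => merged y y.isLt
    exact fun y => (merged y y.isLt).elim .symm fun h => h0a.trans h.symm

/-! ### The conjugating permutation -/

/-- Walks along the full cycles in arrays `4` and `5` simultaneously, starting at `0`. Array `6`
becomes the inverse of array `4`, and array `7` maps the second cycle to the first. -/
def conjugateProgram : Program :=
  .seq (.assign 8 (.const 0)) (.seq (.assign 9 (.const 0))
    (.forLoop 5 3
      (.seq (.store 7 (.var 9) (.var 8))
      (.seq (.store 6 (.entry 4 (.var 8)) (.var 8))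
      (.seq (.assign 8 (.entry 4 (.var 8))) (.assign 9 (.entry 5 (.var 9))))))))

theorem conjugateProgram_runsTo {n : ℕ} [NeZero n] (h2 : 2 ≤ n) {A B : Equiv.Perm (Fin n)}
    (hA : ∀ y, A.SameCycle 0 y) (hB : ∀ y, B.SameCycle 0 y) {s : Memory} (hn : s.var 3 = n)
    (tabA : Tabulates (s.arr 4) A) (tabB : Tabulates (s.arr 5) B) :
    RunsTo conjugateProgram s (1 + (1 + (2 + n * 6))) fun s' =>
      ∃ e : Equiv.Perm (Fin n), e * B * e⁻¹ = A ∧ Tabulates (s'.arr 6) ⇑A⁻¹ ∧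
        Tabulates (s'.arr 7) e := by
  obtain ⟨e, he, hpow⟩ := exists_conj_of_forall_sameCycle (by simpa using h2) hA hB
  let I : ℕ → Memory → Prop := fun i s' =>
    s'.var 8 = ((A ^ i) 0).val ∧ s'.var 9 = ((B ^ i) 0).val ∧
      ∀ j < i, s'.arr 6 ((A ((A ^ j) 0)).val : ℤ) = ((A ^ j) 0).val ∧
        s'.arr 7 (((B ^ j) 0).val : ℤ) = (e ((B ^ j) 0)).val
  refine .assignSeq (.assignSeq (RunsTo.forLoop n I rfl rfl rfl ?_ ?_ ?_ ?_))
  · simpa using hn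
  · simp [I, IntExpr.eval]
  · rintro i hi s₁ - hfr ⟨h8, h9, hI⟩
    have h4 : s₁.arr 4 = s.arr 4 := hfr.arr 4 rfl
    have h5 : s₁.arr 5 = s.arr 5 := hfr.arr 5 rfl
    refine .storeSeq (.storeSeq (.assignSeq (.assign ⟨?_, ?_, fun j hj => ?_⟩)))
    · simp [IntExpr.eval, h8, h4, tabA _, pow_succ']
    · simp [IntExpr.eval, h9, h5, tabB _, pow_succ']
    · have hj' : j < i ∨ j = i := Nat.lt_succ_iff_lt_or_eq.1 hj
      simp only [IntExpr.eval, Memory.setVar_arr, Memory.setEntry_arr, Memory.setEntry_var, h4, h8,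
        h9]
      constructor
      · by_cases h : (A ^ j) 0 = (A ^ i) 0
        · simp [h, tabA _]
        · have : A ((A ^ j) 0) ≠ A ((A ^ i) 0) := fun h' => h (A.injective h')
          simpa [Fin.val_inj, this, tabA _] using
            (hI j (hj'.resolve_right (by rintro rfl; exact h rfl))).1
      · by_cases h : (B ^ j) 0 = (B ^ i) 0
        · simp [h, hpow]
        · simpa [Fin.val_inj, h] using
            (hI j (hj'.resolve_right (by rintro rfl; exact h rfl))).2
  · rintro s₁ - ⟨-, -, hI⟩
    refine ⟨e, he, fun y => ?_, fun y => ?_⟩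
    · obtain ⟨j, hj, h⟩ := (hA (A⁻¹ y)).exists_pow_lt_card
      rw [Fintype.card_fin] at hj
      have := (hI j hj).1
      simpa [h] using this
    · obtain ⟨j, hj, h⟩ := (hB y).exists_pow_lt_card
      rw [Fintype.card_fin] at hj
      have := (hI j hj).2
      rwa [h] at this

/-! ### The output words -/

/-- Appends the values of `e`, for `var 5 = 0, …, var b - 1`, to the first output. -/
def appendProgram (b : ℕ) (e : IntExpr) : Program :=
  .forLoop 5 b (.seq (.store 0 (.var 0) e) (.assign 0 (.add (.var 0) (.const 1))))

theorem appendProgram_runsTo {b : ℕ} {e : IntExpr} {l r : List ℤ} (hb0 : b ≠ 0) (hb5 : b ≠ 5)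
    {s : Memory} (hl : s.HoldsOutput 0 l) (hb : s.var b = r.length)
    (he : ∀ i < r.length, ∀ s' : Memory, s'.var 5 = i → Frame (appendProgram b e) s s' →
      e.eval s' = r.getD i 0) :
    RunsTo (appendProgram b e) s (2 + r.length * 4) fun s' => s'.HoldsOutput 0 (l ++ r) := by
  refine RunsTo.forLoop r.length (fun i s' => s'.HoldsOutput 0 (l ++ r.take i)) rfl
    (by simpa [Program.writesVar] using hb0) (by simpa using hb5) hb ?_ ?_ ?_
  · simpa [Memory.HoldsOutput] using hl
  · rintro i hi s₁ h5 hfr ⟨hlen, hout⟩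
    have htake : l ++ r.take (i + 1) = l ++ r.take i ++ [e.eval s₁] := by
      rw [he i hi s₁ h5 hfr, List.take_succ_eq_append_getElem hi, List.append_assoc,
        List.getD_eq_getElem _ _ hi]
    rw [htake]
    refine .storeSeq (.assign ⟨?_, ?_⟩)
    · simp only [Memory.setVar_var, Memory.setEntry_var, IntExpr.eval, hlen]
      simp [add_assoc]
    · have := HoldsList.concat (g := s₁.arr 0) hout hlen (e.eval s₁)
      simpa [HoldsList, IntExpr.eval] using this
  · intro s₁ _ h
    rwa [List.take_length] at h

/-- Appends the word in array `D`, of length `var D`, to the first output. -/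
def appendWord (D : ℕ) : Program := appendProgram D (.entry D (.var 5))

/-- Appends the inverse of the word in array `D`, of length `var D`, to the first output. -/
def appendInverse (D : ℕ) : Program :=
  appendProgram D (.sub (.const 0) (.entry D (.sub (.sub (.var D) (.const 1)) (.var 5))))

section append

variable {n : ℕ} {D : ℕ} {w v : BraidWord n} {s : Memory}

theorem appendWord_runsTo (hD0 : D ≠ 0) (hD5 : D ≠ 5) (hw : s.HoldsOutput 0 w.code)
    (hv : s.HoldsOutput D v.code) :
    RunsTo (appendWord D) s (2 + v.length * 4) fun s' =>
      s'.HoldsOutput 0 (BraidWord.code (w ++ v)) := by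
  rw [BraidWord.code_append, ← v.length_code]
  refine appendProgram_runsTo hD0 hD5 hw hv.1 fun i hi s' h5 hfr => ?_
  have hD := hfr.arr D (by
    simpa [appendProgram, Program.forLoop, Program.writesArr] using hD0)
  simp only [IntExpr.eval, h5, hD]
  exact hv.2 i hi

theorem appendInverse_runsTo (hD0 : D ≠ 0) (hD5 : D ≠ 5) (hw : s.HoldsOutput 0 w.code)
    (hv : s.HoldsOutput D v.code) :
    RunsTo (appendInverse D) s (2 + v.length * 4) fun s' =>
      s'.HoldsOutput 0 (BraidWord.code (w ++ FreeGroup.invRev v)) := by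
  have hlen : v.length = (v.code.map Neg.neg).reverse.length := by simp [v.length_code]
  rw [BraidWord.code_append, BraidWord.code_invRev, hlen]
  refine appendProgram_runsTo hD0 hD5 hw (by simpa using hv.1) fun i hi s' h5 hfr => ?_
  have hD := hfr.arr D (by
    simpa [appendProgram, Program.forLoop, Program.writesArr] using hD0)
  have hDv := hfr.var D (by
    simp [appendProgram, Program.forLoop, Program.writesVar, hD0, hD5])
  simp only [List.length_reverse, List.length_map] at hi
  have hidx : (v.code.length : ℤ) - 1 - i = ((v.code.length - 1 - i : ℕ) : ℤ) := by omega
  simp only [IntExpr.eval, h5, hD, hDv, hv.1, hidx]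
  rw [hv.2 _ (by omega), List.getD_eq_getElem _ _ (by omega),
    List.getD_eq_getElem _ _ (by simpa using hi)]
  simp

end append

/-- Appends to the first output the inverse of the commutator of the other two outputs. -/
def outputProgram : Program :=
  .seq (appendWord 2) (.seq (appendWord 1) (.seq (appendInverse 2) (appendInverse 1)))

theorem Frame.holdsOutput {P : Program} {s s' : Memory} (h : Frame P s s') {D : ℕ} {l : List ℤ}
    (hv : P.writesVar D = false) (ha : P.writesArr D = false) (hl : s.HoldsOutput D l) :
    s'.HoldsOutput D l := by
  rwa [Memory.HoldsOutput, h.var D hv, h.arr D ha]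

theorem outputProgram_runsTo {n : ℕ} {w d₁ d₂ : BraidWord n} {s : Memory}
    (hw : s.HoldsOutput 0 w.code) (h₁ : s.HoldsOutput 1 d₁.code) (h₂ : s.HoldsOutput 2 d₂.code) :
    RunsTo outputProgram s ((2 + d₂.length * 4) + ((2 + d₁.length * 4) + ((2 + d₂.length * 4) +
      (2 + d₁.length * 4)))) fun s' => s'.HoldsOutput 0 (w.mulCommutatorInv d₁ d₂).code ∧
        s'.HoldsOutput 1 d₁.code ∧ s'.HoldsOutput 2 d₂.code := by
  refine .seq ((appendWord_runsTo (by decide) (by decide) hw h₂).frame.mono le_rfl ?_)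
  rintro s₁ ⟨hw, hfr⟩
  have h₁ := hfr.holdsOutput rfl rfl h₁
  have h₂ := hfr.holdsOutput rfl rfl h₂
  refine .seq ((appendWord_runsTo (by decide) (by decide) hw h₁).frame.mono le_rfl ?_)
  rintro s₂ ⟨hw, hfr⟩
  have h₁ := hfr.holdsOutput rfl rfl h₁
  have h₂ := hfr.holdsOutput rfl rfl h₂
  refine .seq ((appendInverse_runsTo (by decide) (by decide) hw h₂).frame.mono le_rfl ?_)
  rintro s₃ ⟨hw, hfr⟩
  have h₁ := hfr.holdsOutput rfl rfl h₁
  have h₂ := hfr.holdsOutput rfl rfl h₂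
  refine (appendInverse_runsTo (by decide) (by decide) hw h₁).frame.mono le_rfl ?_
  rintro s₄ ⟨hw, hfr⟩
  exact ⟨hw, hfr.holdsOutput rfl rfl h₁, hfr.holdsOutput rfl rfl h₂⟩

/-! ### The algorithm -/

/-- The algorithm for at least two strands. -/
def coreProgram : Program :=
  .seq permProgram (.seq initProgram (.seq mergeProgram (.seq conjugateProgram
    (.seq (sortProgram 6 1) (.seq (sortProgram 7 2) outputProgram)))))

/-- The whole algorithm. The number of strands and the length of the word are moved to the
variables `3` and `4`, and the input word becomes the beginning of the first output. With fewer
than two strands, all words are empty. -/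
def pureCommutatorProgram : Program :=
  .seq (.assign 3 (.var 0)) (.seq (.assign 4 (.var 1)) (.seq (.assign 0 (.var 1))
    (.seq (.assign 1 (.const 0)) (.branch (.lt (.var 3) (.const 2)) .skip coreProgram))))

theorem coreProgram_runsTo {n : ℕ} (h2 : 2 ≤ n) {w : BraidWord n}
    (hw : w.toBraid ∈ commutator (BraidGroup n)) {s : Memory} (hn : s.var 3 = n)
    (hk : s.var 4 = w.length) (h0 : s.HoldsOutput 0 w.code) (h1 : s.var 1 = 0)
    (h2' : s.var 2 = 0) :
    RunsTo coreProgram s (90 * (n + w.length + 1) ^ 2) fun s' =>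
      ∃ (f₁ f₂ : Equiv.Perm (Fin n)) (u₁ u₂ : SymWord n), Descends f₁ u₁ ∧ Descends f₂ u₂ ∧
        w.perm = ⁅u₁.toPerm, u₂.toPerm⁆ ∧
        s'.HoldsOutput 0 (w.mulCommutatorInv u₁.positive u₂.positive).code ∧
        s'.HoldsOutput 1 u₁.positive.code ∧ s'.HoldsOutput 2 u₂.positive.code := by
  have : NeZero n := ⟨by omega⟩
  have run : RunsTo coreProgram s (((2 + n * 3) + (2 + w.length * 8)) + (((2 + n * 4) + 2) +
      ((1 + (2 + n * (5 + n * 8 + 11 + 2))) + ((1 + (1 + (2 + n * 6))) +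
      ((2 + n * (2 + n * 9 + 2)) + ((2 + n * (2 + n * 9 + 2)) + 4 * (2 + n * n * 4))))))) fun s' =>
      ∃ (f₁ f₂ : Equiv.Perm (Fin n)) (u₁ u₂ : SymWord n), Descends f₁ u₁ ∧ Descends f₂ u₂ ∧
        w.perm = ⁅u₁.toPerm, u₂.toPerm⁆ ∧
        s'.HoldsOutput 0 (w.mulCommutatorInv u₁.positive u₂.positive).code ∧
        s'.HoldsOutput 1 u₁.positive.code ∧ s'.HoldsOutput 2 u₂.positive.code := by
    refine .seq ((permProgram_runsTo w hn hk h0.2).frame.mono le_rfl ?_)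
    rintro s₁ ⟨tabP, fr⟩
    have h0 := fr.holdsOutput rfl rfl h0
    have h1 := (fr.var 1 rfl).trans h1
    have h2' := (fr.var 2 rfl).trans h2'
    have hn := (fr.var 3 rfl).trans hn
    refine .seq ((initProgram_runsTo hn tabP).frame.mono le_rfl ?_)
    rintro s₂ ⟨⟨tabA, tabB⟩, fr⟩
    have h0 := fr.holdsOutput rfl rfl h0
    have h1 := (fr.var 1 rfl).trans h1
    have h2' := (fr.var 2 rfl).trans h2'
    have hn := (fr.var 3 rfl).trans hn
    refine .seq ((mergeProgram_runsTo h2 (BraidWord.sign_perm hw) hn tabA tabB).frame.mono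
      le_rfl ?_)
    rintro s₃ ⟨⟨A, B, tabA, tabB, hAB, hA, hB⟩, fr⟩
    have h0 := fr.holdsOutput rfl rfl h0
    have h1 := (fr.var 1 rfl).trans h1
    have h2' := (fr.var 2 rfl).trans h2'
    have hn := (fr.var 3 rfl).trans hn
    refine .seq ((conjugateProgram_runsTo h2 hA hB hn tabA tabB).frame.mono le_rfl ?_)
    rintro s₄ ⟨⟨e, he, tabA, tab_e⟩, fr⟩
    have h0 := fr.holdsOutput rfl rfl h0
    have h1 := (fr.var 1 rfl).trans h1
    have h2' := (fr.var 2 rfl).trans h2'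
    have hn := (fr.var 3 rfl).trans hn
    refine .seq ((sortProgram_runsTo (by decide) (by decide) hn h1 tabA).frame.mono le_rfl ?_)
    rintro s₅ ⟨⟨u₁, hu₁, hu₁A, ho₁⟩, fr⟩
    have h0 := fr.holdsOutput rfl rfl h0
    have h2' := (fr.var 2 rfl).trans h2'
    have hn := (fr.var 3 rfl).trans hn
    have tab_e : Tabulates (s₅.arr 7) e := by rwa [fr.arr 7 rfl]
    refine .seq ((sortProgram_runsTo (by decide) (by decide) hn h2' tab_e).frame.mono le_rfl ?_)
    rintro s₆ ⟨⟨u₂, hu₂, hu₂e, ho₂⟩, fr⟩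
    have h0 := fr.holdsOutput rfl rfl h0
    have ho₁ := fr.holdsOutput rfl rfl ho₁
    rw [← SymWord.code_positive] at ho₁ ho₂
    refine (outputProgram_runsTo h0 ho₁ ho₂).mono ?_ fun s₇ ho =>
      ⟨A⁻¹, e, u₁, u₂, hu₁, hu₂, ?_, ho⟩
    · have l₁ : u₁.positive.length = u₁.length := List.length_map _
      have l₂ : u₂.positive.length = u₂.length := List.length_map _
      have := hu₁.length_le
      have := hu₂.length_le
      omega
    · rw [inv_mul_eq_one] at hu₁A
      rw [← hu₁A, eq_inv_of_mul_eq_one_right hu₂e, commutatorElement_eq_of_conj he, hAB]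
  refine run.mono ?_ fun _ => id
  nlinarith [Nat.zero_le (n * w.length), Nat.zero_le (w.length * w.length)]

theorem pureCommutatorProgram_runsTo {n : ℕ} {w : BraidWord n}
    (hw : w.toBraid ∈ commutator (BraidGroup n)) :
    RunsTo pureCommutatorProgram (Memory.input n w.code) (95 * (n + w.length + 1) ^ 2) fun s' =>
      ∃ (f₁ f₂ : Equiv.Perm (Fin n)) (u₁ u₂ : SymWord n), Descends f₁ u₁ ∧ Descends f₂ u₂ ∧
        w.perm = ⁅u₁.toPerm, u₂.toPerm⁆ ∧
        s'.HoldsOutput 0 (w.mulCommutatorInv u₁.positive u₂.positive).code ∧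
        s'.HoldsOutput 1 u₁.positive.code ∧ s'.HoldsOutput 2 u₂.positive.code := by
  have hpos : 1 ≤ (n + w.length + 1) ^ 2 := Nat.one_le_pow _ _ (by omega)
  refine (RunsTo.assignSeq (.assignSeq (.assignSeq (.assignSeq (.branch (T := 1)
    (T' := 90 * (n + w.length + 1) ^ 2) (fun c => .skip ?_) fun c => ?_))))).mono
    (by omega) fun _ => id
  · have hn : n < 2 := by
      simp [TestExpr.Holds, IntExpr.eval, Memory.input] at c
      omega
    have : IsEmpty (Fin (n - 1)) := ⟨fun i => by have := i.isLt; omega⟩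
    obtain rfl : w = [] := by
      cases w with
      | nil => rfl
      | cons x w => exact isEmptyElim x.1
    refine ⟨1, 1, [], [], trivial, trivial, ?_, ?_⟩
    · simp [BraidWord.perm, SymWord.toPerm]
    · simp [Memory.HoldsOutput, Memory.input, IntExpr.eval, BraidWord.code, SymWord.positive,
        BraidWord.mulCommutatorInv, FreeGroup.invRev]
  · refine coreProgram_runsTo ?_ hw ?_ ?_ ⟨?_, ?_⟩ ?_ ?_
    · simp [TestExpr.Holds, IntExpr.eval, Memory.input] at c
      exact_mod_cast c
    · simp [IntExpr.eval, Memory.input]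
    · simp [IntExpr.eval, Memory.input, BraidWord.length_code]
    · simp [IntExpr.eval, Memory.input]
    · intro i _
      simp [Memory.input]
    · simp [IntExpr.eval]
    · simp [Memory.input]

theorem mainTheorem4
    (hA : ∃ (A : Program) (T : ℕ → ℕ → ℕ), SeparatelyPolynomial T ∧ ComputesCanonicalForm A T) :
    ∃ (C : Program) (T : ℕ → ℕ → ℕ), JointlyPolynomial T ∧ ComputesPureCommutatorForm C T := by
  refine ⟨pureCommutatorProgram, fun n k => 95 * (n + k + 1) ^ 2,
    ⟨.C 95 * (.X + 1) ^ 2, fun n k => by simp⟩, fun n w hw => ?_⟩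
  obtain ⟨s, t, hrun, ht, f₁, f₂, u₁, u₂, h₁, h₂, hperm, ho₀, ho₁, ho₂⟩ :=
    pureCommutatorProgram_runsTo hw
  refine ⟨s, t, w.mulCommutatorInv u₁.positive u₂.positive, u₁.positive, u₂.positive, hrun, ht,
    ho₀, ho₁, ho₂, isPureBraid_mulCommutatorInv hperm, h₁.isPermutationBraid,
    h₂.isPermutationBraid, ?_⟩
  rw [BraidWord.toBraid_mulCommutatorInv, inv_mul_cancel_right]
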